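/- Let $s_\lambda(x_1,\dots,x_N)=\sum_T x^{\mathrm{wt}(T)}$ denote the Schur polynomial, the sum being over semistandard Young tableaux $T$ of shape $\lambda$ with entries in an alphabet of size $N$. For partitions $\mu,\nu$ let $s_\mu[s_\nu]$ be the plethysm, i.e. $s_\mu[s_\nu](x_1,\dots,x_N)$ is obtained by substituting the monomials $x^{\mathrm{wt}(T)}$ of $s_\nu(x_1,\dots,x_N)$ (one for each tableau $T$) for the variables of the Schur polynomial $s_\mu$. The plethysm coefficients $\mathsf a_{\mu[\nu]}^{\lambda}\in\mathbb Z$ are the (uniquely determined, almost all zero) integers, independent of $N$, with $$s_\mu[s_\nu]=\sum_{\lambda}\mathsf a_{\mu[\nu]}^{\lambda}\,s_\lambda \qquad\text{in every number $N\ge 0$ of variables.}$$ For $r\ge 0$ write $r\lambda=(r\lambda_1,r\lambda_2,\dots)$. **Corollary.** Let $\lambda,\mu,\nu$ be fixed partitions with $|\lambda|=|\mu|\cdot|\nu|$. Then the coefficients $\mathsf a_{r\mu[\nu]}^{r\lambda}$, $r\ge 0$, are well defined (for every $r\ge 0$, the expansion of $s_{r\mu}[s_\nu]$ above exists and is unique),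 and the generating function $$\tilde{\mathsf A}^{\lambda}_{\mu[\nu]}(t)=\sum_{r\ge 0}\mathsf a_{r\mu[\nu]}^{r\lambda}\,t^r$$ is a rational function of $t$, i.e. there are polynomials $p,q\in\mathbb Q[t]$ with $q\ne 0$ and $q(t)\,\tilde{\mathsf A}^{\lambda}_{\mu[\nu]}(t)=p(t)$ in $\mathbb Q[[t]]$. -/

import Mathlib

namespace Plethysm

open MvPolynomial

/-- The multiple `r • lam = (r lam_1, r lam_2, …)` of a partition: every row length of the Young
diagram is multiplied by `r` (see `rowLen_scale`). -/
def scale (r : ℕ) (lam : YoungDiagram) : YoungDiagram where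
  cells := (Finset.range (lam.colLen 0) ×ˢ Finset.range (r * lam.rowLen 0)).filter
    fun c => c.2 < r * lam.rowLen c.1
  isLowerSet := by
    rintro ⟨i, j⟩ ⟨i', j'⟩ ⟨hi, hj⟩ h
    simp only [Finset.coe_filter, Finset.mem_product, Finset.mem_range, Set.mem_ofPred_eq] at h hi hj ⊢
    have h1 : r * lam.rowLen i ≤ r * lam.rowLen i' :=
      Nat.mul_le_mul_left r (lam.rowLen_anti i' i hi)
    exact ⟨⟨by omega, by omega⟩, by omega⟩

theorem rowLen_scale (r : ℕ) (lam : YoungDiagram) (i : ℕ) :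
    (scale r lam).rowLen i = r * lam.rowLen i := by
  have key : ∀ j, (i, j) ∈ scale r lam ↔ j < r * lam.rowLen i := by
    intro j
    change (i, j) ∈ (scale r lam).cells ↔ _
    simp only [scale, Finset.mem_filter, Finset.mem_product, Finset.mem_range]
    refine ⟨fun h => h.2, fun h => ⟨⟨?_, ?_⟩, h⟩⟩
    · have h0 : 0 < lam.rowLen i := by
        rcases Nat.eq_zero_or_pos (lam.rowLen i) with h0 | h0
        · simp [h0] at h
        · exact h0
      exact YoungDiagram.mem_iff_lt_colLen.1 (YoungDiagram.mem_iff_lt_rowLen.2 h0)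
    · exact lt_of_lt_of_le h (Nat.mul_le_mul_left r (lam.rowLen_anti 0 i (Nat.zero_le i)))
  refine eq_of_forall_lt_iff fun j => ?_
  rw [← key j, YoungDiagram.mem_iff_lt_rowLen]

/-- Semistandard Young tableaux of shape `lam` with entries in the alphabet `{0, …, N - 1}`. -/
def SSYT (N : ℕ) (lam : YoungDiagram) : Type :=
  {T : SemistandardYoungTableau lam // ∀ c ∈ lam.cells, T c.1 c.2 < N}

instance (N : ℕ) (lam : YoungDiagram) : Finite (SSYT N lam) := by
  refine Finite.of_injective
    (fun (T : SSYT N lam) (c : lam.cells) => (⟨T.1 c.1.1 c.1.2, T.2 c.1 c.2⟩ : Fin N)) ?_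
  intro T T' h
  apply Subtype.ext
  apply SemistandardYoungTableau.ext
  intro i j
  by_cases hc : (i, j) ∈ lam
  · have := congrFun h ⟨(i, j), hc⟩
    simpa using this
  · rw [T.1.zeros hc, T'.1.zeros hc]

noncomputable instance (N : ℕ) (lam : YoungDiagram) : Fintype (SSYT N lam) :=
  Fintype.ofFinite _

/-- The monomial `x^{wt(T)}` of a tableau: the product of `x_e` over all entries `e` of `T`. -/
noncomputable def SSYT.monomial {N : ℕ} {lam : YoungDiagram} (T : SSYT N lam) :
    MvPolynomial (Fin N) ℤ :=
  ∏ c : lam.cells, X ⟨T.1 c.1.1 c.1.2, T.2 c.1 c.2⟩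

/-- The Schur polynomial `s_lam(x_0, …, x_{N-1})`. -/
noncomputable def schur (N : ℕ) (lam : YoungDiagram) : MvPolynomial (Fin N) ℤ :=
  ∑ T : SSYT N lam, T.monomial

/-- The plethysm `s_mu[s_nu](x_0, …, x_{N-1})`: the monomials `x^{wt(T)}` of `s_nu`, one for every
tableau `T`, are substituted for the variables of the Schur polynomial `s_mu` in as many variables
as there are tableaux. (As `s_mu` is symmetric, the enumeration of the tableaux is irrelevant.) -/
noncomputable def plethysm (N : ℕ) (mu nu : YoungDiagram) : MvPolynomial (Fin N) ℤ :=
  aeval (fun i : Fin (Fintype.card (SSYT N nu)) =>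
      ((Fintype.equivFin (SSYT N nu)).symm i).monomial)
    (schur (Fintype.card (SSYT N nu)) mu)

/-- `a` is the family of coefficients of the expansion `s_mu[s_nu] = ∑_lam a_lam s_lam`, as an
identity of symmetric functions, i.e. in every number `N` of variables. -/
def IsSchurExpansion (mu nu : YoungDiagram) (a : YoungDiagram →₀ ℤ) : Prop :=
  ∀ N : ℕ, plethysm N mu nu = a.sum fun lam c => c • schur N lam

open Classical in
/-- The plethysm coefficient `a_{mu[nu]}^lam`, the coefficient of `s_lam` in `s_mu[s_nu]`. -/
noncomputable def plethysmCoeff (mu nu lam : YoungDiagram) : ℤ :=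
  if h : ∃ a : YoungDiagram →₀ ℤ, IsSchurExpansion mu nu a then h.choose lam else 0

/-- The formal power series `F(t)` is (the expansion at `0` of) a rational function `p(t) / q(t)`. -/
def IsRationalFunction (F : PowerSeries ℚ) : Prop :=
  ∃ p q : Polynomial ℚ, q ≠ 0 ∧ (q : PowerSeries ℚ) * F = (p : PowerSeries ℚ)

end Plethysm

/-!
The proof follows the coefficient of a Schur polynomial through three descriptions of Schur
polynomials.

Recording, for every `k`, the shape formed by the entries less than `k` turns a semistandard
tableau into a Gelfand–Tsetlin pattern, a chain of interlacing sequences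
(`sum_SSYT_eq_gtPoly`). Peeling off the top row of the pattern matches a row reduction of the
alternant `det (x_j ^ alpha_i)`, which gives the bialternant formula (`alternant_mul_gtPoly`).

From the bialternant formula, Schur polynomials are symmetric, and multiplication by the staircase
alternant identifies symmetric with alternating polynomials. Hence the Schur polynomials of the
diagrams with at most `N` rows form a basis of the symmetric polynomials in `N` variables, and the
coefficient of `s_lam` in `f` is the coefficient of `x ^ (lam + staircase)` in the product of `f`
with the staircase alternant (`schurCoeff_sum`, `exists_schur_expansion`). The plethysm is
symmetric, homogeneous of degree `|mu| |nu|` and compatible with setting variables to zero, so its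
expansions in the various numbers of variables agree (`existsUnique_isSchurExpansion`).

For the rationality take `N` to be the number of rows of `lam`, so that the set of tableaux of
shape `nu`, which is the alphabet of `s_{r mu}`, does not depend on `r`. The coefficient of
`s_{r lam}` in `s_{r mu}[s_nu]` is then a sum over the terms of the staircase alternant of signed
numbers of Gelfand–Tsetlin patterns with top row `r mu` and with a content that is affine in `r`
(`schurCoeff_plethysm_eq`). Gelfand–Tsetlin patterns form a finitely generated commutative monoid
(`exists_pattern_monoid`, by Gordan's lemma), and after homogenization the patterns to be counted
are the elements of degree `1` in a finitely generated commutative monoid, counted by an additive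
form `r`. The generating function of such a count is rational (`isRationalFunction_of_fg`): the
lexicographically least representatives of the elements form a lower set of `ℕ^m`, and for lower
sets the claim follows by slicing along a coordinate (`isRationalFunction_level`).
-/

namespace Plethysm

/-! ### Rational power series -/

theorem isRationalFunction_polynomial (p : Polynomial ℚ) :
    IsRationalFunction (p : PowerSeries ℚ) :=
  ⟨p, 1, one_ne_zero, by simp⟩

theorem isRationalFunction_zero : IsRationalFunction 0 :=
  ⟨0, 1, one_ne_zero, by simp⟩

theorem IsRationalFunction.add {F G : PowerSeries ℚ} (hF : IsRationalFunction F)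
    (hG : IsRationalFunction G) : IsRationalFunction (F + G) := by
  obtain ⟨p, q, hq, h⟩ := hF
  obtain ⟨p', q', hq', h'⟩ := hG
  refine ⟨q' * p + q * p', q * q', mul_ne_zero hq hq', ?_⟩
  push_cast
  rw [← h, ← h']
  ring

theorem IsRationalFunction.polynomial_mul {F : PowerSeries ℚ} (hF : IsRationalFunction F)
    (a : Polynomial ℚ) : IsRationalFunction ((a : PowerSeries ℚ) * F) := by
  obtain ⟨p, q, hq, h⟩ := hF
  refine ⟨a * p, q, hq, ?_⟩
  push_cast
  rw [← h]
  ring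

theorem IsRationalFunction.of_polynomial_mul {F : PowerSeries ℚ} {a : Polynomial ℚ} (ha : a ≠ 0)
    (h : IsRationalFunction ((a : PowerSeries ℚ) * F)) : IsRationalFunction F := by
  obtain ⟨p, q, hq, h⟩ := h
  refine ⟨p, q * a, mul_ne_zero hq ha, ?_⟩
  push_cast
  rw [← h]
  ring

theorem isRationalFunction_sum {ι : Type*} (s : Finset ι) (F : ι → PowerSeries ℚ)
    (h : ∀ i ∈ s, IsRationalFunction (F i)) : IsRationalFunction (∑ i ∈ s, F i) :=
  Finset.sum_induction F IsRationalFunction (fun _ _ => .add) isRationalFunction_zero h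

theorem IsRationalFunction.X_pow_mul {F : PowerSeries ℚ} (hF : IsRationalFunction F) (n : ℕ) :
    IsRationalFunction (PowerSeries.X ^ n * F) := by
  simpa using hF.polynomial_mul (Polynomial.X ^ n)

/-! ### Counting the elements of a finitely generated commutative monoid -/

/-- In a well-quasi-order, lower sets satisfy the descending chain condition. -/
instance wellFoundedLT_lowerSet {α : Type*} [Preorder α] [WellQuasiOrderedLE α] :
    WellFoundedLT (LowerSet α) := by
  rw [WellFoundedLT, isWellFounded_iff, wellFounded_iff_isEmpty_descending_chain]
  refine ⟨fun ⟨f, hf⟩ => ?_⟩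
  have hanti : StrictAnti f := strictAnti_nat_of_succ_lt hf
  have hx : ∀ n, ∃ x, x ∈ f n ∧ x ∉ f (n + 1) := fun n =>
    Set.exists_of_ssubset (show (f (n + 1) : Set α) ⊂ f n from hf n)
  choose x hx hx' using hx
  obtain ⟨m, n, hmn, hle⟩ := wellQuasiOrdered_le x
  exact hx' m ((f (m + 1)).lower hle (hanti.antitone hmn (hx n)))

open Matrix in
/-- The points `p` of `L` with `w · p = j` and `d · p = r`. -/
def level {m : ℕ} (L : LowerSet (Fin m → ℕ)) (d w : Fin m → ℕ) (j r : ℕ) : Set (Fin m → ℕ) :=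
  {p | p ∈ L ∧ w ⬝ᵥ p = j ∧ d ⬝ᵥ p = r}

/-- The slice `p 0 = 0` of a lower set. -/
def bottomSlice {m : ℕ} (L : LowerSet (Fin (m + 1) → ℕ)) : LowerSet (Fin m → ℕ) where
  carrier := {q | (Fin.cons 0 q : Fin (m + 1) → ℕ) ∈ L}
  lower' := fun _ _ h hp => L.lower (Fin.cons_le_cons.2 ⟨le_rfl, h⟩) hp

/-- The part `1 ≤ p 0` of a lower set, moved down by one unit. -/
def shiftDown {m : ℕ} (L : LowerSet (Fin (m + 1) → ℕ)) : LowerSet (Fin (m + 1) → ℕ) where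
  carrier := {p | p + Pi.single 0 1 ∈ L}
  lower' := fun _ _ h hp => L.lower (by gcongr) hp

theorem shiftDown_le {m : ℕ} (L : LowerSet (Fin (m + 1) → ℕ)) : shiftDown L ≤ L :=
  fun _ hp => L.lower le_self_add hp

section Level

variable {m : ℕ} (L : LowerSet (Fin (m + 1) → ℕ)) (d w : Fin (m + 1) → ℕ) (j r : ℕ)

theorem level_eq_union :
    level L d w j r =
      (fun q : Fin m → ℕ => (Fin.cons 0 q : Fin (m + 1) → ℕ)) ''
        level (bottomSlice L) (Fin.tail d) (Fin.tail w) j r ∪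
      (· + Pi.single 0 1) ''
        {p | w 0 ≤ j ∧ d 0 ≤ r ∧ p ∈ level (shiftDown L) d w (j - w 0) (r - d 0)} := by
  ext p
  simp only [level, Set.mem_union, Set.mem_image, Set.mem_ofPred_eq]
  constructor
  · rintro ⟨hp, hw, hd⟩
    rcases Nat.eq_zero_or_pos (p 0) with h0 | h0
    · left
      have hp0 : (Fin.cons 0 (Fin.tail p) : Fin (m + 1) → ℕ) = p := by
        rw [← h0, Fin.cons_self_tail]
      refine ⟨Fin.tail p, ⟨?_, ?_, ?_⟩, hp0⟩
      · change (Fin.cons 0 (Fin.tail p) : Fin (m + 1) → ℕ) ∈ L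
        rwa [hp0]
      · simpa [dotProduct, Fin.sum_univ_succ, h0, Fin.tail] using hw
      · simpa [dotProduct, Fin.sum_univ_succ, h0, Fin.tail] using hd
    · right
      obtain ⟨p, rfl⟩ : ∃ p' : Fin (m + 1) → ℕ, p = p' + Pi.single 0 1 := by
        refine ⟨p - Pi.single 0 1, (tsub_add_cancel_of_le ?_).symm⟩
        intro i
        rcases eq_or_ne i 0 with rfl | hi
        · rw [Pi.single_eq_same]
          exact h0
        · simp [hi]
      rw [dotProduct_add, dotProduct_single, mul_one] at hw hd
      exact ⟨p, ⟨by omega, by omega, hp, by omega, by omega⟩, rfl⟩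
  · rintro (⟨q, ⟨hq, hw, hd⟩, rfl⟩ | ⟨q, ⟨hj, hr, hq, hw, hd⟩, rfl⟩)
    · refine ⟨hq, ?_, ?_⟩
      · simpa [dotProduct, Fin.sum_univ_succ, Fin.tail] using hw
      · simpa [dotProduct, Fin.sum_univ_succ, Fin.tail] using hd
    · refine ⟨hq, ?_, ?_⟩
      · rw [dotProduct_add, dotProduct_single, mul_one]
        omega
      · rw [dotProduct_add, dotProduct_single, mul_one]
        omega

theorem level_ncard (h : (level L d w j r).Finite) :
    (level L d w j r).ncard =
      (level (bottomSlice L) (Fin.tail d) (Fin.tail w) j r).ncard +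
        if w 0 ≤ j ∧ d 0 ≤ r then (level (shiftDown L) d w (j - w 0) (r - d 0)).ncard else 0 := by
  have hunion := level_eq_union L d w j r
  rw [hunion] at h
  rw [hunion, Set.ncard_union_eq ?_ (h.subset Set.subset_union_left)
    (h.subset Set.subset_union_right),
    Set.ncard_image_of_injective _ (Fin.cons_right_injective (α := fun _ => ℕ) 0),
    Set.ncard_image_of_injective _ (add_left_injective _)]
  · congr 1
    split_ifs with hc
    · simp [hc.1, hc.2]
    · rw [Set.ncard_eq_zero (by
        convert Set.finite_empty (α := Fin (m + 1) → ℕ); ext p; simp; tauto)]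
      ext p
      simp
      tauto
  · rw [Set.disjoint_left]
    rintro _ ⟨q, _, rfl⟩ ⟨p, _, hp⟩
    simpa using congrFun hp 0

theorem level_bottomSlice_finite (h : (level L d w j r).Finite) :
    (level (bottomSlice L) (Fin.tail d) (Fin.tail w) j r).Finite := by
  rw [level_eq_union] at h
  exact (h.subset Set.subset_union_left).of_finite_image
    (Fin.cons_right_injective (α := fun _ => ℕ) 0).injOn

theorem level_shiftDown_finite (h : (level L d w (j + w 0) (r + d 0)).Finite) :
    (level (shiftDown L) d w j r).Finite := by
  rw [level_eq_union] at h
  simpa using (h.subset Set.subset_union_right).of_finite_image (add_left_injective _).injOn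

end Level

theorem mk_level_eq {m : ℕ} (L : LowerSet (Fin (m + 1) → ℕ)) (d w : Fin (m + 1) → ℕ) (j : ℕ)
    (h : ∀ r, (level L d w j r).Finite) :
    (PowerSeries.mk fun r => ((level L d w j r).ncard : ℚ)) =
      (PowerSeries.mk fun r =>
        ((level (bottomSlice L) (Fin.tail d) (Fin.tail w) j r).ncard : ℚ)) +
      PowerSeries.X ^ d 0 * if w 0 ≤ j then
        (PowerSeries.mk fun r => ((level (shiftDown L) d w (j - w 0) r).ncard : ℚ)) else 0 := by
  ext r
  rw [PowerSeries.coeff_mk, level_ncard L d w j r (h r), map_add, PowerSeries.coeff_mk,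
    PowerSeries.coeff_X_pow_mul']
  push_cast
  congr 1
  by_cases hj : w 0 ≤ j <;> by_cases hr : d 0 ≤ r <;> simp [hj, hr]

/-- The points of a lower set of `ℕ^m` on a hyperplane `w · p = j`, counted by a linear form `d`,
have a rational generating function. The points with `p 0 = 0` form a lower set in one dimension
less; those with `1 ≤ p 0` form, after a shift, a lower set which is either strictly smaller, or
the same one, and then the generating function satisfies a linear equation. -/
theorem isRationalFunction_level {m : ℕ} (L : LowerSet (Fin m → ℕ)) (d w : Fin m → ℕ) (j : ℕ)
    (h : ∀ r, (level L d w j r).Finite) :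
    IsRationalFunction (PowerSeries.mk fun r => ((level L d w j r).ncard : ℚ)) := by
  induction m generalizing j with
  | zero =>
    have : (PowerSeries.mk fun r => ((level L d w j r).ncard : ℚ)) =
        (Polynomial.C ((level L d w j 0).ncard : ℚ) : Polynomial ℚ) := by
      ext r
      rw [PowerSeries.coeff_mk, Polynomial.coeff_coe, Polynomial.coeff_C]
      rcases eq_or_ne r 0 with rfl | hr
      · simp
      · have : level L d w j r = ∅ := by
          ext p
          simp [level, hr.symm]
        simp [this, hr]
    rw [this]
    exact isRationalFunction_polynomial _
  | succ m ih =>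
    induction L using WellFoundedLT.induction generalizing j with
    | _ L ihL =>
    induction j using Nat.strong_induction_on with
    | _ j ihj =>
    have h0 : IsRationalFunction (PowerSeries.mk fun r =>
        ((level (bottomSlice L) (Fin.tail d) (Fin.tail w) j r).ncard : ℚ)) :=
      ih _ _ _ _ fun r => level_bottomSlice_finite L d w j r (h r)
    have key := mk_level_eq L d w j h
    by_cases hj : w 0 ≤ j
    swap
    · rw [key, if_neg hj, mul_zero, add_zero]
      exact h0
    rw [if_pos hj] at key
    have hfin : ∀ r, (level (shiftDown L) d w (j - w 0) r).Finite := fun r =>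
      level_shiftDown_finite L d w (j - w 0) r (by rw [Nat.sub_add_cancel hj]; exact h _)
    rcases (shiftDown_le L).lt_or_eq with hlt | heq
    · rw [key]
      exact h0.add ((ihL _ hlt _ hfin).X_pow_mul _)
    rcases Nat.eq_zero_or_pos (w 0) with hw | hw
    swap
    · rw [key]
      rw [heq] at hfin ⊢
      exact h0.add ((ihj _ (by omega) hfin).X_pow_mul _)
    rw [heq, hw, Nat.sub_zero] at key
    rcases Nat.eq_zero_or_pos (d 0) with hd | hd
    · -- `L` is invariant under the shift, so finiteness leaves no points at all
      have hempty : ∀ r, level L d w j r = ∅ := by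
        intro r
        by_contra hne
        obtain ⟨p, hp⟩ := Set.nonempty_iff_ne_empty.2 hne
        refine (h r).not_infinite (Set.infinite_of_injective_forall_mem
          (f := fun k : ℕ => p + Pi.single 0 k) ?_ ?_)
        · intro k k' hk
          simpa using hk
        · intro k
          induction k with
          | zero => simpa using hp
          | succ k ihk =>
            refine ⟨?_, ?_, ?_⟩
            · have : p + Pi.single 0 k ∈ shiftDown L := by rw [heq]; exact ihk.1
              have : p + Pi.single 0 k + Pi.single 0 1 ∈ L := this
              rwa [add_assoc, ← Pi.single_add] at this
            · simpa [dotProduct_add, hw] using hp.2.1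
            · simpa [dotProduct_add, hd] using hp.2.2
      simp only [hempty]
      convert isRationalFunction_zero using 1
      ext r
      simp
    · refine IsRationalFunction.of_polynomial_mul (a := 1 - Polynomial.X ^ d 0) ?_ ?_
      · intro h0
        simpa [hd.ne'] using congrArg (Polynomial.eval 0) h0
      · convert h0 using 1
        push_cast
        rw [sub_mul, one_mul]
        nth_rw 1 [key]
        ring

/-- The elements `c` of a finitely generated commutative monoid with `w c = 1`, counted by the
values of an additive form `d`, have a rational generating function. Every element has a least
representative in `ℕ^m` for the lexicographic order, and these representatives form a lower set. -/
theorem isRationalFunction_of_fg {C : Type*} [AddCommMonoid C] [AddMonoid.FG C] (d w : C →+ ℕ)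
    (h : ∀ r, {c | w c = 1 ∧ d c = r}.Finite) :
    IsRationalFunction (PowerSeries.mk fun r => ({c | w c = 1 ∧ d c = r}.ncard : ℚ)) := by
  obtain ⟨m, f, hf⟩ :=
    AddSubmonoid.fg_iff_exists_fin_addMonoidHom.1 (AddMonoid.FG.fg_top (M := C))
  rw [AddMonoidHom.mrange_eq_top] at hf
  let L : LowerSet (Fin m → ℕ) :=
    { carrier := {p | ∀ q, f q = f p → toLex p ≤ toLex q}
      lower' := by
        intro p p' hle hp q hq
        obtain ⟨e, rfl⟩ := exists_add_of_le hle
        have := hp (q + e) (by rw [map_add, map_add, hq])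
        rw [toLex_add, toLex_add] at this
        exact le_of_add_le_add_right this }
  have hL : Set.BijOn f L Set.univ := by
    refine ⟨fun _ _ => trivial, ?_, ?_⟩
    · intro p hp q hq hpq
      exact toLex.injective (le_antisymm (hp q hpq.symm) (hq p hpq))
    · intro c _
      have hwf : WellFounded ((· < ·) : Lex (Fin m → ℕ) → Lex (Fin m → ℕ) → Prop) := wellFounded_lt
      have hne : {p : Lex (Fin m → ℕ) | f (ofLex p) = c}.Nonempty := by
        obtain ⟨p, hp⟩ := hf c
        exact ⟨toLex p, hp⟩
      refine ⟨ofLex (hwf.min _ hne), ?_, hwf.min_mem _ hne⟩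
      intro q hq
      refine hwf.min_le (x := toLex q) (s := {p : Lex (Fin m → ℕ) | f (ofLex p) = c}) ?_
      exact hq.trans (hwf.min_mem _ hne)
  have hdot : ∀ (g : C →+ ℕ) (p : Fin m → ℕ),
      g (f p) = (fun i => g (f (Pi.single i 1))) ⬝ᵥ p := by
    intro g p
    conv_lhs => rw [← Finset.univ_sum_single p]
    rw [map_sum, map_sum]
    refine Finset.sum_congr rfl fun i _ => ?_
    have : Pi.single i (p i) = p i • (Pi.single i 1 : Fin m → ℕ) := by
      rw [← Pi.single_smul]; simp
    rw [this, map_nsmul, map_nsmul, smul_eq_mul, mul_comm]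
  have himage : ∀ r, f '' level L (fun i => d (f (Pi.single i 1)))
      (fun i => w (f (Pi.single i 1))) 1 r = {c | w c = 1 ∧ d c = r} := by
    intro r
    ext c
    simp only [level, ← hdot, Set.mem_image, Set.mem_ofPred_eq]
    constructor
    · rintro ⟨p, ⟨-, h1, h2⟩, rfl⟩
      exact ⟨h1, h2⟩
    · rintro ⟨h1, h2⟩
      obtain ⟨p, hp, rfl⟩ := hL.surjOn (Set.mem_univ c)
      exact ⟨p, ⟨hp, h1, h2⟩, rfl⟩
  have hinj : ∀ r, Set.InjOn f (level L (fun i => d (f (Pi.single i 1)))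
      (fun i => w (f (Pi.single i 1))) 1 r) := fun r => hL.injOn.mono fun p hp => hp.1
  have hcard := fun r => (himage r) ▸ (hinj r).ncard_image
  simp only [hcard]
  refine isRationalFunction_level L _ _ 1 fun r => ?_
  exact Set.Finite.of_finite_image (by rw [himage]; exact h r) (hinj r)

/-! ### Gelfand–Tsetlin patterns and semistandard tableaux -/

/-- The sequences `kap` of length `N` interlacing `lam`: `lam (i + 1) ≤ kap i ≤ lam i`. -/
def interlacing {N : ℕ} (lam : Fin (N + 1) → ℕ) : Finset (Fin N → ℕ) :=
  Fintype.piFinset fun i => Finset.Icc (lam i.succ) (lam i.castSucc)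

theorem mem_interlacing {N : ℕ} {lam : Fin (N + 1) → ℕ} {kap : Fin N → ℕ} :
    kap ∈ interlacing lam ↔ ∀ i, lam i.succ ≤ kap i ∧ kap i ≤ lam i.castSucc := by
  simp [interlacing]

theorem antitone_of_mem_interlacing {N : ℕ} {lam : Fin (N + 1) → ℕ} {kap : Fin N → ℕ}
    (h : kap ∈ interlacing lam) : Antitone kap := by
  rw [mem_interlacing] at h
  cases N with
  | zero => exact fun i => i.elim0
  | succ N =>
    rw [Fin.antitone_iff_succ_le]
    intro i
    exact (h i.succ).2.trans (h i.castSucc).1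

/-- The generating polynomial of the Gelfand–Tsetlin patterns with top row `lam`: a pattern is a
chain of interlacing sequences of lengths `N, N - 1, …, 0`, and `x i` records the difference of the
sums of two consecutive rows. The natural subtraction in the exponent does not truncate, because
`kap i ≤ lam i` for interlacing sequences. -/
def gtPoly {R : Type*} [CommSemiring R] : (N : ℕ) → (Fin N → ℕ) → (Fin N → R) → R
  | 0, _, _ => 1
  | N + 1, lam, x => ∑ kap ∈ interlacing lam,
      gtPoly N kap (Fin.init x) * x (Fin.last N) ^ (∑ i, lam i - ∑ i, kap i)

/-- The Young diagram with row lengths `kap 0 ≥ kap 1 ≥ …`. -/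
def diagram {N : ℕ} (kap : Fin N → ℕ) (h : Antitone kap) : YoungDiagram where
  cells := Finset.univ.biUnion fun i : Fin N => {(i : ℕ)} ×ˢ Finset.range (kap i)
  isLowerSet := by
    rintro ⟨i, j⟩ ⟨i', j'⟩ ⟨hi, hj⟩ hm
    simp only [Finset.coe_biUnion, Set.mem_iUnion, Finset.mem_coe, Finset.mem_product,
      Finset.mem_singleton, Finset.mem_range, Finset.mem_univ, exists_prop, true_and] at hm hi hj ⊢
    obtain ⟨k, rfl, hk⟩ := hm
    exact ⟨⟨i', by omega⟩, rfl, (hj.trans_lt hk).trans_le (h (show (⟨i', _⟩ : Fin N) ≤ k from hi))⟩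

theorem mem_diagram {N : ℕ} {kap : Fin N → ℕ} {h : Antitone kap} {i j : ℕ} :
    (i, j) ∈ diagram kap h ↔ ∃ hi : i < N, j < kap ⟨i, hi⟩ := by
  rw [← YoungDiagram.mem_cells]
  simp only [diagram, Finset.mem_biUnion, Finset.mem_univ, true_and, Finset.mem_product,
    Finset.mem_singleton, Finset.mem_range]
  constructor
  · rintro ⟨k, rfl, hk⟩
    exact ⟨k.2, hk⟩
  · rintro ⟨hi, hk⟩
    exact ⟨⟨i, hi⟩, rfl, hk⟩

theorem rowLen_diagram {N : ℕ} {kap : Fin N → ℕ} {h : Antitone kap} (i : Fin N) :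
    (diagram kap h).rowLen i = kap i := by
  refine eq_of_forall_lt_iff fun j => ?_
  rw [← YoungDiagram.mem_iff_lt_rowLen, mem_diagram]
  simp

theorem colLen_diagram_le {N : ℕ} {kap : Fin N → ℕ} {h : Antitone kap} :
    (diagram kap h).colLen 0 ≤ N := by
  by_contra! hN
  rw [← YoungDiagram.mem_iff_lt_colLen, mem_diagram] at hN
  exact lt_irrefl _ hN.1

theorem lt_of_mem_of_colLen_le {N : ℕ} {lam : YoungDiagram} (hN : lam.colLen 0 ≤ N) {i j : ℕ}
    (h : (i, j) ∈ lam) : i < N :=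
  (YoungDiagram.mem_iff_lt_colLen.1 (lam.up_left_mem le_rfl (Nat.zero_le j) h)).trans_le hN

theorem card_eq_sum_rowLen {N : ℕ} {lam : YoungDiagram} (hN : lam.colLen 0 ≤ N) :
    lam.cells.card = ∑ i : Fin N, lam.rowLen i := by
  rw [Fin.sum_univ_eq_sum_range lam.rowLen N,
    Finset.card_eq_sum_card_fiberwise (f := Prod.fst) (t := Finset.range N)]
  · exact Finset.sum_congr rfl fun i _ => (lam.rowLen_eq_card (i := i)).symm
  · rintro ⟨i, j⟩ h
    simpa using lt_of_mem_of_colLen_le hN h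

/-- Two Young diagrams with at most `N` rows and the same row lengths agree. -/
theorem eq_of_rowLen_eq {N : ℕ} {lam lam' : YoungDiagram} (hN : lam.colLen 0 ≤ N)
    (hN' : lam'.colLen 0 ≤ N) (h : ∀ i : Fin N, lam.rowLen i = lam'.rowLen i) : lam = lam' := by
  refine SetLike.ext fun ⟨i, j⟩ => ?_
  constructor <;> intro hm
  · have := h ⟨i, lt_of_mem_of_colLen_le hN hm⟩
    rw [YoungDiagram.mem_iff_lt_rowLen] at hm ⊢
    simp only at this
    omega
  · have := h ⟨i, lt_of_mem_of_colLen_le hN' hm⟩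
    rw [YoungDiagram.mem_iff_lt_rowLen] at hm ⊢
    simp only at this
    omega

theorem le_entry {lam : YoungDiagram} (T : SemistandardYoungTableau lam) {i j : ℕ}
    (h : (i, j) ∈ lam) : i ≤ T i j := by
  induction i with
  | zero => exact Nat.zero_le _
  | succ i ih =>
    have h1 := ih (lam.up_left_mem (Nat.le_succ i) le_rfl h)
    have h2 := T.col_strict (Nat.lt_add_one i) h
    omega

/-- A diagram with more than `N` rows carries no tableau with entries in an alphabet of size
`N`. -/
theorem isEmpty_SSYT {N : ℕ} {lam : YoungDiagram} (h : N < lam.colLen 0) :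
    IsEmpty (SSYT N lam) := by
  refine ⟨fun T => ?_⟩
  have hm := YoungDiagram.mem_iff_lt_colLen.2 h
  have h1 := T.2 (N, 0) hm
  have h2 := le_entry T.1 hm
  simp only at h1
  omega

section Branching

variable {N : ℕ} {lam : YoungDiagram}

/-- The cells of a tableau whose entries are not the largest letter `N`. -/
def lowerPart (T : SSYT (N + 1) lam) : YoungDiagram where
  cells := lam.cells.filter fun c => T.1 c.1 c.2 < N
  isLowerSet := by
    rintro ⟨i, j⟩ ⟨i', j'⟩ ⟨hi, hj⟩ h
    simp only [Finset.coe_filter, Set.mem_ofPred_eq, YoungDiagram.mem_cells] at h hi hj ⊢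
    refine ⟨lam.up_left_mem hi hj h.1, ?_⟩
    exact ((T.1.col_weak hi (lam.up_left_mem le_rfl hj h.1)).trans
      (T.1.row_weak_of_le hj h.1)).trans_lt h.2

theorem mem_lowerPart {T : SSYT (N + 1) lam} {i j : ℕ} :
    (i, j) ∈ lowerPart T ↔ (i, j) ∈ lam ∧ T.1 i j < N := by
  rw [← YoungDiagram.mem_cells]
  simp [lowerPart]

theorem colLen_lowerPart_le (T : SSYT (N + 1) lam) : (lowerPart T).colLen 0 ≤ N := by
  by_contra! h
  rw [← YoungDiagram.mem_iff_lt_colLen, mem_lowerPart] at h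
  have := le_entry T.1 h.1
  omega

theorem rowLen_lowerPart_mem_interlacing (T : SSYT (N + 1) lam) :
    (fun i : Fin N => (lowerPart T).rowLen i) ∈
      interlacing fun i : Fin (N + 1) => lam.rowLen i := by
  rw [mem_interlacing]
  intro i
  constructor
  · refine le_of_forall_lt fun j hj => ?_
    rw [Fin.val_succ, ← YoungDiagram.mem_iff_lt_rowLen] at hj
    rw [← YoungDiagram.mem_iff_lt_rowLen, mem_lowerPart]
    have h1 := T.1.col_strict (Nat.lt_add_one (i : ℕ)) hj
    have h2 := T.2 _ hj
    simp only at h2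
    exact ⟨lam.up_left_mem (Nat.le_succ _) le_rfl hj, by omega⟩
  · refine le_of_forall_lt fun j hj => ?_
    rw [← YoungDiagram.mem_iff_lt_rowLen, mem_lowerPart] at hj
    rw [Fin.val_castSucc, ← YoungDiagram.mem_iff_lt_rowLen]
    exact hj.1

/-- The restriction of a tableau to its cells with entries less than `N`. -/
def restrict (T : SSYT (N + 1) lam) {D : YoungDiagram} (h : lowerPart T = D) : SSYT N D :=
  ⟨{  entry := fun i j => if (i, j) ∈ D then T.1 i j else 0
      row_weak' := by
        subst h
        intro i j1 j2 hj hm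
        rw [if_pos hm, if_pos ((lowerPart T).up_left_mem le_rfl hj.le hm)]
        exact T.1.row_weak hj (mem_lowerPart.1 hm).1
      col_strict' := by
        subst h
        intro i1 i2 j hi hm
        rw [if_pos hm, if_pos ((lowerPart T).up_left_mem hi.le le_rfl hm)]
        exact T.1.col_strict hi (mem_lowerPart.1 hm).1
      zeros' := fun hm => if_neg hm }, by
    subst h
    rintro ⟨i, j⟩ hm
    change (if (i, j) ∈ lowerPart T then T.1 i j else 0) < N
    rw [if_pos ((YoungDiagram.mem_cells _).1 hm)]
    exact (mem_lowerPart.1 hm).2⟩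

theorem restrict_apply (T : SSYT (N + 1) lam) {D : YoungDiagram} (h : lowerPart T = D) (i j : ℕ) :
    (restrict T h).1 i j = if (i, j) ∈ D then T.1 i j else 0 := rfl

/-- The extension of a tableau of shape `D` to the shape `lam` by the letter `N`. -/
def extend {D : YoungDiagram} (T : SSYT N D) (hN : lam.colLen 0 ≤ N + 1)
    (h : (fun i : Fin N => D.rowLen i) ∈ interlacing fun i : Fin (N + 1) => lam.rowLen i) :
    SSYT (N + 1) lam :=
  ⟨{  entry := fun i j => if (i, j) ∈ D then T.1 i j else if (i, j) ∈ lam then N else 0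
      row_weak' := by
        intro i j1 j2 hj hm
        by_cases hD : (i, j2) ∈ D
        · rw [if_pos hD, if_pos (D.up_left_mem le_rfl hj.le hD)]
          exact T.1.row_weak hj hD
        · rw [if_neg hD, if_pos hm]
          split_ifs with h1
          · exact (T.2 _ h1).le
          · exact le_rfl
          · exact Nat.zero_le _
      col_strict' := by
        intro i1 i2 j hi hm
        by_cases hD : (i2, j) ∈ D
        · rw [if_pos hD, if_pos (D.up_left_mem hi.le le_rfl hD)]
          exact T.1.col_strict hi hD
        · have hi2 := lt_of_mem_of_colLen_le hN hm
          have h1 : (i1, j) ∈ D := by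
            rw [YoungDiagram.mem_iff_lt_rowLen]
            refine lt_of_lt_of_le ?_ (mem_interlacing.1 h ⟨i1, by omega⟩).1
            rw [Fin.succ_mk, ← YoungDiagram.mem_iff_lt_rowLen]
            exact lam.up_left_mem hi le_rfl hm
          rw [if_neg hD, if_pos hm, if_pos h1]
          exact T.2 _ h1
      zeros' := by
        intro i j hm
        have hD : (i, j) ∉ D := by
          intro hD
          have hi := T.2 _ hD
          have hi' := le_entry T.1 hD
          simp only at hi
          rw [YoungDiagram.mem_iff_lt_rowLen] at hD hm
          exact hm (hD.trans_le (mem_interlacing.1 h ⟨i, by omega⟩).2)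
        rw [if_neg hD, if_neg hm] }, by
    rintro ⟨i, j⟩ hm
    change (if (i, j) ∈ D then T.1 i j else if (i, j) ∈ lam then N else 0) < N + 1
    split_ifs with h1
    · exact (T.2 _ h1).trans (Nat.lt_succ_self N)
    · exact Nat.lt_succ_self N
    · exact Nat.succ_pos N⟩

theorem extend_apply {D : YoungDiagram} (T : SSYT N D) (hN : lam.colLen 0 ≤ N + 1)
    (h : (fun i : Fin N => D.rowLen i) ∈ interlacing fun i : Fin (N + 1) => lam.rowLen i)
    (i j : ℕ) : (extend T hN h).1 i j =
      if (i, j) ∈ D then T.1 i j else if (i, j) ∈ lam then N else 0 := rfl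

theorem le_of_mem_interlacing {D : YoungDiagram} (hD : D.colLen 0 ≤ N)
    (h : (fun i : Fin N => D.rowLen i) ∈ interlacing fun i : Fin (N + 1) => lam.rowLen i) :
    D ≤ lam := by
  rintro ⟨i, j⟩ hm
  have hi := lt_of_mem_of_colLen_le hD hm
  rw [YoungDiagram.mem_iff_lt_rowLen] at hm ⊢
  exact hm.trans_le (mem_interlacing.1 h ⟨i, hi⟩).2

theorem lowerPart_extend {D : YoungDiagram} (T : SSYT N D) (hN : lam.colLen 0 ≤ N + 1)
    (hD : D.colLen 0 ≤ N)
    (h : (fun i : Fin N => D.rowLen i) ∈ interlacing fun i : Fin (N + 1) => lam.rowLen i) :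
    lowerPart (extend T hN h) = D := by
  refine SetLike.ext fun ⟨i, j⟩ => ?_
  rw [mem_lowerPart, extend_apply]
  constructor
  · rintro ⟨h1, h2⟩
    by_contra h3
    rw [if_neg h3, if_pos h1] at h2
    exact lt_irrefl _ h2
  · intro h1
    rw [if_pos h1]
    exact ⟨le_of_mem_interlacing hD h h1, T.2 _ h1⟩

theorem entry_eq_of_notMem_lowerPart (T : SSYT (N + 1) lam) {i j : ℕ} (hm : (i, j) ∈ lam)
    (h : (i, j) ∉ lowerPart T) : T.1 i j = N := by
  have h1 : T.1 i j < N + 1 := T.2 _ hm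
  rw [mem_lowerPart] at h
  have h2 : ¬ T.1 i j < N := fun h2 => h ⟨hm, h2⟩
  omega

theorem prod_entries_eq {R : Type*} [CommSemiring R] (x : ℕ → R) (T : SSYT (N + 1) lam)
    {D : YoungDiagram} (h : lowerPart T = D) :
    ∏ c ∈ lam.cells, x (T.1 c.1 c.2) =
      (∏ c ∈ D.cells, x ((restrict T h).1 c.1 c.2)) * x N ^ (lam.cells.card - D.cells.card) := by
  have hsub : D.cells ⊆ lam.cells := by
    rintro ⟨i, j⟩ hc
    exact (mem_lowerPart.1 (h ▸ hc : (i, j) ∈ lowerPart T)).1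
  rw [← Finset.prod_sdiff hsub, mul_comm, ← Finset.card_sdiff_of_subset hsub]
  congr 1
  · refine Finset.prod_congr rfl fun c hc => ?_
    rw [restrict_apply, if_pos ((YoungDiagram.mem_cells _).1 hc)]
  · refine Finset.prod_eq_pow_card fun ⟨i, j⟩ hc => ?_
    rw [Finset.mem_sdiff] at hc
    rw [entry_eq_of_notMem_lowerPart T hc.1 (h ▸ hc.2)]

end Branching

/-- A tableau is the same as a Gelfand–Tsetlin pattern: the rows of the pattern are the shapes
formed by the entries less than `N`, less than `N - 1`, …. -/
theorem sum_SSYT_eq_gtPoly {R : Type*} [CommSemiring R] (x : ℕ → R) (N : ℕ) (lam : YoungDiagram)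
    (hN : lam.colLen 0 ≤ N) :
    ∑ T : SSYT N lam, ∏ c ∈ lam.cells, x (T.1 c.1 c.2) =
      gtPoly N (fun i => lam.rowLen i) fun i => x i := by
  induction N generalizing lam with
  | zero =>
    have hcells : lam.cells = ∅ := by
      rw [← Finset.card_eq_zero, card_eq_sum_rowLen hN]
      simp
    have : Unique (SSYT 0 lam) :=
      { default := ⟨default, by simp [hcells]⟩
        uniq := fun T => Subtype.ext (SemistandardYoungTableau.ext fun i j => by
          have : (i, j) ∉ lam := by rw [← YoungDiagram.mem_cells]; simp [hcells]
          rw [T.1.zeros this, SemistandardYoungTableau.zeros _ this]) }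
    simp [hcells, gtPoly]
  | succ N ih =>
    rw [gtPoly, ← Finset.sum_fiberwise_of_maps_to
      (g := fun T : SSYT (N + 1) lam => fun i : Fin N => (lowerPart T).rowLen i)
      fun T _ => rowLen_lowerPart_mem_interlacing T]
    refine Finset.sum_congr rfl fun kap hkap => ?_
    have hanti := antitone_of_mem_interlacing hkap
    have hD : (diagram kap hanti).colLen 0 ≤ N := colLen_diagram_le
    have hrow : (fun i : Fin N => (diagram kap hanti).rowLen i) = kap :=
      funext fun i => rowLen_diagram i
    have hint : (fun i : Fin N => (diagram kap hanti).rowLen i) ∈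
        interlacing fun i : Fin (N + 1) => lam.rowLen i := by rwa [hrow]
    have hlow : ∀ T : SSYT (N + 1) lam,
        (fun i : Fin N => (lowerPart T).rowLen i) = kap → lowerPart T = diagram kap hanti := by
      intro T hT
      refine eq_of_rowLen_eq (colLen_lowerPart_le T) hD fun i => ?_
      rw [rowLen_diagram]
      exact congrFun hT i
    have hinit : (Fin.init fun i : Fin (N + 1) => x i) = fun i : Fin N => x i := by
      ext i
      simp [Fin.init]
    rw [hinit, Fin.val_last]
    have ih' := ih _ hD
    rw [hrow] at ih'
    rw [← ih', Finset.sum_mul]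
    refine Finset.sum_bij' (fun T hT => restrict T (hlow T (Finset.mem_filter.1 hT).2))
      (fun T _ => extend T hN hint) (fun _ _ => Finset.mem_univ _) ?_ ?_ ?_ ?_
    · intro T _
      rw [Finset.mem_filter]
      refine ⟨Finset.mem_univ _, ?_⟩
      rw [lowerPart_extend T hN hD hint, hrow]
    · intro T hT
      have hl := hlow T (Finset.mem_filter.1 hT).2
      refine Subtype.ext (SemistandardYoungTableau.ext fun i j => ?_)
      rw [extend_apply, restrict_apply]
      split_ifs with h1 h2
      · rfl
      · exact (entry_eq_of_notMem_lowerPart T h2 (hl ▸ h1)).symm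
      · exact (T.1.zeros h2).symm
    · intro T _
      refine Subtype.ext (SemistandardYoungTableau.ext fun i j => ?_)
      rw [restrict_apply, extend_apply]
      split_ifs with h1
      · rfl
      · exact (T.1.zeros h1).symm
    · intro T hT
      rw [prod_entries_eq x T (hlow T (Finset.mem_filter.1 hT).2), card_eq_sum_rowLen hN,
        card_eq_sum_rowLen hD]
      simp only [rowLen_diagram]

theorem aeval_schur_eq_sum {R : Type*} [CommRing R] [Algebra ℤ R] (N : ℕ) (lam : YoungDiagram)
    (x : Fin N → R) :
    MvPolynomial.aeval x (schur N lam) =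
      ∑ T : SSYT N lam, ∏ c : lam.cells, x ⟨T.1 c.1.1 c.1.2, T.2 c.1 c.2⟩ := by
  simp [schur, SSYT.monomial, map_sum, map_prod]

theorem aeval_schur_eq_gtPoly {R : Type*} [CommRing R] [Algebra ℤ R] {N : ℕ} {lam : YoungDiagram}
    (hN : lam.colLen 0 ≤ N) (x : Fin N → R) :
    MvPolynomial.aeval x (schur N lam) = gtPoly N (fun i => lam.rowLen i) x := by
  let y : ℕ → R := fun n => if h : n < N then x ⟨n, h⟩ else 0
  have hy : x = fun i : Fin N => y i := by
    ext i
    simp [y]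
  rw [aeval_schur_eq_sum, hy, ← sum_SSYT_eq_gtPoly y N lam hN]
  refine Finset.sum_congr rfl fun T _ => ?_
  exact Finset.prod_coe_sort lam.cells fun c => y (T.1 c.1 c.2)

theorem schur_eq_gtPoly {N : ℕ} {lam : YoungDiagram} (hN : lam.colLen 0 ≤ N) :
    schur N lam = gtPoly N (fun i => lam.rowLen i) MvPolynomial.X := by
  rw [← aeval_schur_eq_gtPoly hN]
  exact (MvPolynomial.aeval_X_left_apply _).symm

theorem schur_eq_zero {N : ℕ} {lam : YoungDiagram} (hN : N < lam.colLen 0) : schur N lam = 0 := by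
  have := isEmpty_SSYT hN
  simp [schur]

/-! ### The bialternant formula -/

/-- The alternant `det (x_j ^ alpha_i)`. -/
def alternant {R : Type*} [CommRing R] {N : ℕ} (alpha : Fin N → ℕ) (x : Fin N → R) : R :=
  (Matrix.of fun i j => x j ^ alpha i).det

/-- The staircase `(N - 1, N - 2, …, 0)`. -/
def staircase (N : ℕ) (i : Fin N) : ℕ := N - 1 - i

theorem staircase_castSucc {N : ℕ} (i : Fin N) :
    staircase (N + 1) i.castSucc = staircase N i + 1 := by
  simp only [staircase, Fin.val_castSucc]
  omega

theorem staircase_succ {N : ℕ} (i : Fin N) : staircase (N + 1) i.succ = staircase N i := by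
  simp only [staircase, Fin.val_succ]
  omega

theorem staircase_last {N : ℕ} : staircase (N + 1) (Fin.last N) = 0 := by
  simp [staircase]

theorem strictAnti_staircase (N : ℕ) : StrictAnti (staircase N) := by
  intro i j hij
  simp only [staircase]
  omega

/-- `(x - y) ∑_{k=b}^{a} x^(k + s) y^(a - k)` telescopes. -/
theorem sub_mul_sum_Icc {R : Type*} [CommRing R] (x y : R) {a b : ℕ} (h : b ≤ a) (s : ℕ) :
    (x - y) * ∑ k ∈ Finset.Icc b a, x ^ (k + s) * y ^ (a - k) =
      x ^ (a + (s + 1)) - y ^ (a + 1 - b) * x ^ (b + s) := by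
  obtain ⟨n, rfl⟩ := exists_add_of_le h
  have h1 : ∑ k ∈ Finset.Icc b (b + n), x ^ (k + s) * y ^ (b + n - k) =
      x ^ (b + s) * ∑ k ∈ Finset.range (n + 1), x ^ k * y ^ (n + 1 - 1 - k) := by
    rw [← Finset.Ico_add_one_right_eq_Icc, Finset.sum_Ico_eq_sum_range, Finset.mul_sum,
      show b + n + 1 - b = n + 1 by omega]
    refine Finset.sum_congr rfl fun k hk => ?_
    rw [show b + n - (b + k) = n + 1 - 1 - k by omega]
    ring
  rw [h1, mul_left_comm, mul_comm (x - y), geom_sum₂_mul, show b + n + 1 - b = n + 1 by omega]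
  ring

/-- Subtracting multiples of the next row clears the last column of an alternant. -/
theorem alternant_succ {R : Type*} [CommRing R] {N : ℕ} (alpha : Fin (N + 1) → ℕ)
    (h : Antitone alpha) (x : Fin (N + 1) → R) :
    alternant alpha x = (Matrix.of fun i j : Fin N =>
        x j.castSucc ^ alpha i.castSucc -
          x (Fin.last N) ^ (alpha i.castSucc - alpha i.succ) * x j.castSucc ^ alpha i.succ).det *
      x (Fin.last N) ^ alpha (Fin.last N) := by
  let A : Matrix (Fin (N + 1)) (Fin (N + 1)) R := Matrix.of fun i j => x j ^ alpha i
  let c : Fin N → R := fun i => x (Fin.last N) ^ (alpha i.castSucc - alpha i.succ)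
  let B : Matrix (Fin (N + 1)) (Fin (N + 1)) R := Matrix.of
    (Fin.lastCases (A (Fin.last N)) fun i j => A i.castSucc j - c i * A i.succ j)
  have hB : ∀ i j, B (Fin.castSucc i) j = A i.castSucc j - c i * A i.succ j := by
    intro i j
    simp [B]
  have hBlast : ∀ j, B (Fin.last N) j = A (Fin.last N) j := by
    intro j
    simp [B]
  have hdet : A.det = B.det := by
    rw [← Matrix.det_submatrix_equiv_self Fin.revPerm A,
      ← Matrix.det_submatrix_equiv_self Fin.revPerm B]
    refine Matrix.det_eq_of_forall_row_eq_smul_add_pred (fun i => c i.rev) ?_ ?_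
    · intro j
      simp [hBlast]
    · intro i j
      simp [Fin.rev_succ, Fin.rev_castSucc, hB]
  have hcol : ∀ i : Fin N, B i.castSucc (Fin.last N) = 0 := by
    intro i
    rw [hB]
    simp only [A, c, Matrix.of_apply]
    rw [← pow_add, Nat.sub_add_cancel (h (Fin.castSucc_lt_succ (i := i)).le), sub_self]
  change A.det = _
  rw [hdet, Matrix.det_succ_column B (Fin.last N), Fin.sum_univ_castSucc,
    Finset.sum_eq_zero (fun i _ => by rw [hcol]; simp), zero_add, hBlast, mul_comm,
    ← two_mul, pow_mul, neg_one_sq, one_pow, one_mul]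
  congr 2
  ext i j
  simp [hB, A, c]

/-- The branching rule for alternants. -/
theorem alternant_branching {R : Type*} [CommRing R] {N : ℕ} (lam : Fin (N + 1) → ℕ)
    (h : Antitone lam) (x : Fin (N + 1) → R) :
    alternant (lam + staircase (N + 1)) x =
      (∏ j : Fin N, (x j.castSucc - x (Fin.last N))) *
        ∑ kap ∈ interlacing lam, alternant (kap + staircase N) (Fin.init x) *
          x (Fin.last N) ^ (∑ i, lam i - ∑ i, kap i) := by
  set y := x (Fin.last N) with hy
  -- the power of `y` is distributed over the rows: `lam i - kap i` goes to row `i`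
  have hpow : ∀ kap ∈ interlacing lam, alternant (kap + staircase N) (Fin.init x) *
      y ^ (∑ i, lam i - ∑ i, kap i) =
      (Matrix.of fun i j : Fin N =>
        x j.castSucc ^ (kap i + staircase N i) * y ^ (lam i.castSucc - kap i)).det *
        y ^ lam (Fin.last N) := by
    intro kap hkap
    rw [mem_interlacing] at hkap
    have hexp : ∑ i, lam i - ∑ i, kap i =
        ∑ i : Fin N, (lam i.castSucc - kap i) + lam (Fin.last N) := by
      have hle : ∑ i, kap i ≤ ∑ i : Fin N, lam i.castSucc :=
        Finset.sum_le_sum fun i _ => (hkap i).2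
      rw [Fin.sum_univ_castSucc, Finset.sum_tsub_distrib _ fun i _ => (hkap i).2]
      omega
    rw [hexp, pow_add, ← mul_assoc, ← Finset.prod_pow_eq_pow_sum, mul_comm (alternant _ _),
      alternant, ← Matrix.det_mul_column]
    congr 2
    ext i j
    simp [Fin.init, mul_comm]
  rw [Finset.sum_congr rfl hpow, ← Finset.sum_mul, alternant_succ (lam + staircase (N + 1))
    (h.add (strictAnti_staircase _).antitone), ← hy]
  -- by multilinearity, the sum over the box `interlacing lam` can be taken row by row
  have hsum : ∑ kap ∈ interlacing lam, (Matrix.of fun i j : Fin N =>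
      x j.castSucc ^ (kap i + staircase N i) * y ^ (lam i.castSucc - kap i)).det =
      (Matrix.of fun i j : Fin N => ∑ k ∈ Finset.Icc (lam i.succ) (lam i.castSucc),
        x j.castSucc ^ (k + staircase N i) * y ^ (lam i.castSucc - k)).det := by
    have := (Matrix.detRowAlternating (n := Fin N) (R := R)).toMultilinearMap.map_sum_finset
      (fun i k j => x j.castSucc ^ (k + staircase N i) * y ^ (lam i.castSucc - k))
      fun i => Finset.Icc (lam i.succ) (lam i.castSucc)
    refine this.symm.trans (congrArg Matrix.det ?_)
    ext i j
    simp
  rw [hsum, ← mul_assoc, ← Matrix.det_mul_row]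
  congr 2
  · ext i j
    simp only [Matrix.of_apply, Pi.add_apply, staircase_castSucc, staircase_succ]
    rw [sub_mul_sum_Icc _ _ (h (Fin.castSucc_lt_succ (i := i)).le)]
    congr 3
    omega
  · simp [staircase_last]

theorem alternant_staircase_succ {R : Type*} [CommRing R] {N : ℕ} (x : Fin (N + 1) → R) :
    alternant (staircase (N + 1)) x =
      (∏ j : Fin N, (x j.castSucc - x (Fin.last N))) * alternant (staircase N) (Fin.init x) := by
  have h0 : interlacing (0 : Fin (N + 1) → ℕ) = {0} := by
    ext kap
    rw [mem_interlacing, Finset.mem_singleton, funext_iff]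
    simp
  have := alternant_branching (0 : Fin (N + 1) → ℕ) antitone_const x
  rw [h0, Finset.sum_singleton] at this
  simpa using this

/-- The bialternant formula: `det (x_j ^ (N - 1 - i)) s_lam = det (x_j ^ (lam_i + N - 1 - i))`. -/
theorem alternant_mul_gtPoly {R : Type*} [CommRing R] {N : ℕ} (lam : Fin N → ℕ) (h : Antitone lam)
    (x : Fin N → R) :
    alternant (staircase N) x * gtPoly N lam x = alternant (lam + staircase N) x := by
  induction N with
  | zero => simp [alternant, gtPoly]
  | succ N ih =>
    rw [alternant_staircase_succ, alternant_branching lam h, gtPoly, mul_assoc, Finset.mul_sum]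
    congr 1
    refine Finset.sum_congr rfl fun kap hkap => ?_
    rw [← mul_assoc, ih kap (antitone_of_mem_interlacing hkap)]

/-! ### Alternating polynomials and Schur expansions in finitely many variables -/

section Alternating

open MvPolynomial

variable {N : ℕ}

/-- The exponent vector of the monomial `∏ i, X i ^ alpha i`. -/
noncomputable def expo (alpha : Fin N → ℕ) : Fin N →₀ ℕ := Finsupp.equivFunOnFinite.symm alpha

theorem expo_injective : Function.Injective (expo : (Fin N → ℕ) → (Fin N →₀ ℕ)) :=
  Finsupp.equivFunOnFinite.symm.injective

theorem expo_add (alpha beta : Fin N → ℕ) : expo (alpha + beta) = expo alpha + expo beta := by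
  ext i
  simp [expo]

theorem monomial_expo (alpha : Fin N → ℕ) :
    (monomial (expo alpha) 1 : MvPolynomial (Fin N) ℤ) = ∏ i, X i ^ alpha i := by
  rw [monomial_eq, Finsupp.prod_fintype _ _ (by simp)]
  simp [expo]

theorem alternant_X_eq (alpha : Fin N → ℕ) :
    alternant alpha (X : Fin N → MvPolynomial (Fin N) ℤ) =
      ∑ s : Equiv.Perm (Fin N), monomial (expo (alpha ∘ s)) ((Equiv.Perm.sign s : ℤˣ) : ℤ) := by
  rw [alternant, Matrix.det_apply]
  refine Finset.sum_congr rfl fun s _ => ?_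
  have : (monomial (expo (alpha ∘ s)) ((Equiv.Perm.sign s : ℤˣ) : ℤ) : MvPolynomial (Fin N) ℤ) =
      ((Equiv.Perm.sign s : ℤˣ) : ℤ) • monomial (expo (alpha ∘ s)) 1 := by
    rw [smul_monomial, smul_eq_mul, mul_one]
  rw [this, monomial_expo, Units.smul_def]
  congr 1

theorem perm_eq_one_of_strictAnti {alpha beta : Fin N → ℕ} (ha : StrictAnti alpha)
    (hb : StrictAnti beta) {s : Equiv.Perm (Fin N)} (h : alpha ∘ s = beta) : s = 1 := by
  have hs : StrictMono s := by
    intro i j hij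
    rw [← ha.lt_iff_gt]
    have := hb hij
    rwa [← h] at this
  let e : Fin N ≃o Fin N := ⟨s, hs.le_iff_le⟩
  have : e = OrderIso.refl _ := Subsingleton.elim _ _
  ext i
  simpa [e] using congrArg (fun f : Fin N ≃o Fin N => ((f i : Fin N) : ℕ)) this

theorem coeff_alternant {alpha beta : Fin N → ℕ} (ha : StrictAnti alpha) (hb : StrictAnti beta) :
    coeff (expo beta) (alternant alpha (X : Fin N → MvPolynomial (Fin N) ℤ)) =
      if alpha = beta then 1 else 0 := by
  rw [alternant_X_eq, coeff_sum]
  simp only [coeff_monomial, expo_injective.eq_iff]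
  split_ifs with h
  · subst h
    rw [Finset.sum_eq_single 1]
    · simp
    · intro s _ hs
      rw [if_neg fun h => hs (perm_eq_one_of_strictAnti ha ha h)]
    · simp
  · refine Finset.sum_eq_zero fun s _ => if_neg fun hs => h ?_
    rw [perm_eq_one_of_strictAnti ha hb hs] at hs
    simpa using hs

theorem alternant_staircase_ne_zero :
    alternant (staircase N) (X : Fin N → MvPolynomial (Fin N) ℤ) ≠ 0 := by
  intro h
  have := coeff_alternant (strictAnti_staircase N) (strictAnti_staircase N)
  rw [h, if_pos rfl, coeff_zero] at this
  exact zero_ne_one this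

theorem rename_alternant (alpha : Fin N → ℕ) (s : Equiv.Perm (Fin N)) :
    rename s (alternant alpha (X : Fin N → MvPolynomial (Fin N) ℤ)) =
      ((Equiv.Perm.sign s : ℤˣ) : MvPolynomial (Fin N) ℤ) * alternant alpha X := by
  rw [alternant, ← Matrix.det_permute', AlgHom.map_det]
  congr 1
  ext i j
  simp

/-- A polynomial is alternating if permuting the variables multiplies it by the sign. -/
def IsAlternating (h : MvPolynomial (Fin N) ℤ) : Prop :=
  ∀ s : Equiv.Perm (Fin N), rename s h = ((Equiv.Perm.sign s : ℤˣ) : MvPolynomial (Fin N) ℤ) * h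

theorem IsAlternating.coeff_comp {h : MvPolynomial (Fin N) ℤ} (hh : IsAlternating h)
    (beta : Fin N → ℕ) (s : Equiv.Perm (Fin N)) :
    coeff (expo (beta ∘ s)) h = ((Equiv.Perm.sign s : ℤˣ) : ℤ) * coeff (expo beta) h := by
  have h1 : Finsupp.mapDomain s (expo (beta ∘ s)) = expo beta := by
    ext i
    rw [Finsupp.mapDomain_equiv_apply]
    simp [expo]
  have h2 := coeff_rename_mapDomain s s.injective h (expo (beta ∘ s))
  rw [h1, hh s, ← zsmul_eq_mul, coeff_smul, smul_eq_mul] at h2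
  exact h2.symm

/-- An alternating polynomial is determined by its coefficients at strictly decreasing
exponents. -/
theorem IsAlternating.eq_zero {h : MvPolynomial (Fin N) ℤ} (hh : IsAlternating h)
    (h0 : ∀ beta : Fin N → ℕ, StrictAnti beta → coeff (expo beta) h = 0) : h = 0 := by
  ext u
  obtain ⟨beta, rfl⟩ : ∃ beta, u = expo beta := ⟨u, by ext; simp [expo]⟩
  rw [coeff_zero]
  let s := Tuple.sort (OrderDual.toDual ∘ beta)
  have hs : Antitone (beta ∘ s) := fun i j hij =>
    Tuple.monotone_sort (OrderDual.toDual ∘ beta) hij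
  have hzero : coeff (expo (beta ∘ s)) h = 0 := by
    by_cases hinj : Function.Injective (beta ∘ s)
    · exact h0 _ (hs.strictAnti_of_injective hinj)
    · rw [Function.not_injective_iff] at hinj
      obtain ⟨i, j, hij, hne⟩ := hinj
      have h1 : (beta ∘ s) ∘ Equiv.swap i j = beta ∘ s := by
        ext k
        by_cases hi : k = i
        · subst hi; simpa using hij.symm
        by_cases hj : k = j
        · subst hj; simpa using hij
        simp [Equiv.swap_apply_of_ne_of_ne hi hj]
      have h2 := hh.coeff_comp (beta ∘ s) (Equiv.swap i j)
      -- an exponent fixed by a transposition has a coefficient equal to its own negative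
      rw [h1, Equiv.Perm.sign_swap hne] at h2
      simp at h2
      omega
  rw [hh.coeff_comp] at hzero
  simpa using hzero

theorem isAlternating_alternant_mul {f : MvPolynomial (Fin N) ℤ} (hf : f.IsSymmetric)
    (alpha : Fin N → ℕ) : IsAlternating (alternant alpha X * f) := by
  intro s
  rw [map_mul, rename_alternant, hf s, mul_assoc]

theorem antitone_rowLen (lam : YoungDiagram) : Antitone fun i : Fin N => lam.rowLen i :=
  fun i j hij => lam.rowLen_anti i j hij

/-- The exponents `lam_i + N - 1 - i`. -/
def shifted (N : ℕ) (lam : YoungDiagram) : Fin N → ℕ :=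
  (fun i : Fin N => lam.rowLen i) + staircase N

theorem strictAnti_shifted (lam : YoungDiagram) : StrictAnti (shifted N lam) :=
  (antitone_rowLen lam).add_strictAnti (strictAnti_staircase N)

theorem shifted_inj {lam lam' : YoungDiagram} (h : lam.colLen 0 ≤ N) (h' : lam'.colLen 0 ≤ N)
    (heq : shifted N lam = shifted N lam') : lam = lam' :=
  eq_of_rowLen_eq h h' fun i => congrFun (add_right_cancel heq) i

theorem exists_shifted_eq {beta : Fin N → ℕ} (hb : StrictAnti beta) :
    ∃ lam : YoungDiagram, lam.colLen 0 ≤ N ∧ shifted N lam = beta := by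
  have hgap : ∀ (k : ℕ) (i : Fin N) (h : i + k < N), beta ⟨i + k, h⟩ + k ≤ beta i := by
    intro k
    induction k with
    | zero => intro i h; exact le_rfl
    | succ k ih =>
      intro i h
      have h1 := ih i (by omega)
      have h2 : beta ⟨i + (k + 1), h⟩ < beta ⟨i + k, by omega⟩ := hb (by simp [Fin.lt_def])
      omega
  have hdec : ∀ i : Fin N, staircase N i ≤ beta i := by
    intro i
    have := hgap (staircase N i) i (by simp only [staircase]; omega)
    omega
  have hanti : Antitone fun i => beta i - staircase N i := by
    intro i j hij
    have h1 : (i : ℕ) ≤ j := hij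
    have h2 := hgap (j - i) i (by omega)
    have h3 : (⟨i + (j - i), by omega⟩ : Fin N) = j := Fin.ext (by simp only; omega)
    rw [h3] at h2
    simp only [staircase]
    omega
  refine ⟨diagram _ hanti, colLen_diagram_le, ?_⟩
  ext i
  have := hdec i
  simp only [shifted, Pi.add_apply, rowLen_diagram]
  omega

theorem alternant_mul_schur {lam : YoungDiagram} (h : lam.colLen 0 ≤ N) :
    alternant (staircase N) X * schur N lam = alternant (shifted N lam) X := by
  rw [schur_eq_gtPoly h, alternant_mul_gtPoly _ (antitone_rowLen lam)]
  rfl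

theorem isSymmetric_schur (N : ℕ) (lam : YoungDiagram) : (schur N lam).IsSymmetric := by
  intro s
  rcases le_or_gt (lam.colLen 0) N with h | h
  swap
  · rw [schur_eq_zero h, map_zero]
  have h1 : ((Equiv.Perm.sign s : ℤˣ) : MvPolynomial (Fin N) ℤ) ≠ 0 := by
    simp
  refine mul_left_cancel₀ (mul_ne_zero h1 alternant_staircase_ne_zero) ?_
  rw [← rename_alternant, ← map_mul, alternant_mul_schur h, rename_alternant, rename_alternant,
    mul_assoc, alternant_mul_schur h]

/-- The coefficient at `lam` of the Schur expansion of a symmetric polynomial, for a diagram `lam`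
with at most `N` rows. -/
noncomputable def schurCoeff (f : MvPolynomial (Fin N) ℤ) (lam : YoungDiagram) : ℤ :=
  coeff (expo (shifted N lam)) (alternant (staircase N) X * f)

open Classical in
theorem schurCoeff_schur {lam kap : YoungDiagram} (h : lam.colLen 0 ≤ N) :
    schurCoeff (schur N kap) lam = if kap = lam then 1 else 0 := by
  rw [schurCoeff]
  rcases le_or_gt (kap.colLen 0) N with hk | hk
  · rw [alternant_mul_schur hk, coeff_alternant (strictAnti_shifted _) (strictAnti_shifted _)]
    refine if_congr ⟨fun heq => shifted_inj hk h heq, fun heq => heq ▸ rfl⟩ rfl rfl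
  · rw [schur_eq_zero hk, mul_zero, coeff_zero, if_neg]
    rintro rfl
    omega

theorem schurCoeff_sum (a : YoungDiagram →₀ ℤ) {lam : YoungDiagram} (h : lam.colLen 0 ≤ N) :
    schurCoeff (a.sum fun kap c => c • schur N kap) lam = a lam := by
  classical
  have : ∀ kap, schurCoeff (a kap • schur N kap) lam = if kap = lam then a kap else 0 := by
    intro kap
    have := schurCoeff_schur (kap := kap) h
    rw [schurCoeff] at this ⊢
    rw [mul_smul_comm, coeff_smul, this]
    simp
  rw [Finsupp.sum, schurCoeff, Finset.mul_sum, coeff_sum]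
  simp only [schurCoeff] at this
  simp only [this]
  rw [Finset.sum_ite_eq']
  simp +contextual

/-- Every symmetric polynomial is a linear combination of Schur polynomials. -/
theorem exists_schur_expansion {f : MvPolynomial (Fin N) ℤ} (hf : f.IsSymmetric) :
    ∃ a : YoungDiagram →₀ ℤ, (∀ lam, a lam ≠ 0 → lam.colLen 0 ≤ N ∧ schurCoeff f lam ≠ 0) ∧
      f = a.sum fun lam c => c • schur N lam := by
  classical
  have hfin : (Function.support fun lam : YoungDiagram =>
      if lam.colLen 0 ≤ N then schurCoeff f lam else 0).Finite := by
    refine Set.Finite.of_injOn (f := fun lam => expo (shifted N lam)) ?_ ?_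
      (alternant (staircase N) X * f).support.finite_toSet
    · intro lam hlam
      rw [Function.mem_support, ite_ne_right_iff] at hlam
      simpa [schurCoeff] using hlam.2
    · intro lam hlam lam' hlam' h
      rw [Function.mem_support, ite_ne_right_iff] at hlam hlam'
      exact shifted_inj hlam.1 hlam'.1 (expo_injective h)
  let a := Finsupp.ofSupportFinite _ hfin
  have ha : ∀ lam, a lam = if lam.colLen 0 ≤ N then schurCoeff f lam else 0 := fun _ => rfl
  refine ⟨a, fun lam h => ?_, ?_⟩
  · rwa [ha, ite_ne_right_iff] at h
  have hsymm : (f - a.sum fun lam c => c • schur N lam).IsSymmetric := by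
    refine hf.sub ((symmetricSubalgebra (Fin N) ℤ).sum_mem fun lam _ => ?_)
    have hmem : schur N lam ∈ symmetricSubalgebra (Fin N) ℤ := isSymmetric_schur N lam
    exact zsmul_mem hmem _
  have h0 := (isAlternating_alternant_mul hsymm (staircase N)).eq_zero ?_
  · exact sub_eq_zero.1 ((mul_eq_zero.1 h0).resolve_left alternant_staircase_ne_zero)
  · intro beta hb
    obtain ⟨lam, hlam, rfl⟩ := exists_shifted_eq hb
    have h1 := schurCoeff_sum a hlam
    rw [ha, if_pos hlam] at h1
    rw [mul_sub, coeff_sub]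
    exact sub_eq_zero.2 h1.symm

/-- The Schur expansion of a homogeneous symmetric polynomial involves only diagrams with as many
cells as the degree. -/
theorem card_eq_of_schurCoeff_ne_zero {f : MvPolynomial (Fin N) ℤ} {d : ℕ} (hf : f.IsHomogeneous d)
    {lam : YoungDiagram} (hlam : lam.colLen 0 ≤ N) (h : schurCoeff f lam ≠ 0) : lam.card = d := by
  have h1 : (alternant (staircase N) (X : Fin N → MvPolynomial (Fin N) ℤ)).IsHomogeneous
      (∑ i, staircase N i) := by
    rw [alternant_X_eq]
    refine IsHomogeneous.sum _ _ _ fun s _ => isHomogeneous_monomial _ ?_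
    rw [Finsupp.degree_eq_sum]
    exact Equiv.sum_comp s (staircase N)
  have h2 : Finsupp.degree (expo (shifted N lam)) = ∑ i, staircase N i + d := by
    by_contra hne
    exact h ((h1.mul hf).coeff_eq_zero hne)
  have h3 : Finsupp.degree (expo (shifted N lam)) =
      ∑ i : Fin N, lam.rowLen i + ∑ i, staircase N i := by
    rw [Finsupp.degree_eq_sum, ← Finset.sum_add_distrib]
    rfl
  rw [YoungDiagram.card, card_eq_sum_rowLen hlam]
  omega

end Alternating

/-! ### The Schur expansion of a plethysm -/

section Expansion

open MvPolynomial

theorem aeval_comp_perm_schur {R : Type*} [CommRing R] [Algebra ℤ R] {N : ℕ} (lam : YoungDiagram)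
    (x : Fin N → R) (s : Equiv.Perm (Fin N)) :
    aeval (x ∘ s) (schur N lam) = aeval x (schur N lam) := by
  rw [← aeval_rename, isSymmetric_schur N lam s]

/-- A tableau over an alphabet is a tableau over every larger alphabet. -/
def SSYT.castLE {n m : ℕ} (h : n ≤ m) {lam : YoungDiagram} (T : SSYT n lam) : SSYT m lam :=
  ⟨T.1, fun c hc => (T.2 c hc).trans_le h⟩

theorem SSYT.castLE_injective {n m : ℕ} (h : n ≤ m) {lam : YoungDiagram} :
    Function.Injective (SSYT.castLE h : SSYT n lam → SSYT m lam) :=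
  fun _ _ hT => Subtype.ext (Subtype.ext_iff.1 hT :)

theorem SSYT.exists_le_of_notMem_range {n m : ℕ} (h : n ≤ m) {lam : YoungDiagram} {T : SSYT m lam}
    (hT : T ∉ Set.range (SSYT.castLE h)) : ∃ c ∈ lam.cells, n ≤ T.1 c.1 c.2 := by
  by_contra! hc
  exact hT ⟨⟨T.1, hc⟩, rfl⟩

/-- Variables that are set to zero may be dropped from a Schur polynomial. -/
theorem aeval_schur_castLE {R : Type*} [CommRing R] [Algebra ℤ R] {n m : ℕ} (h : n ≤ m)
    (lam : YoungDiagram) (x : Fin m → R) (hx : ∀ i : Fin m, n ≤ i → x i = 0) :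
    aeval x (schur m lam) = aeval (x ∘ Fin.castLE h) (schur n lam) := by
  rw [aeval_schur_eq_sum, aeval_schur_eq_sum]
  symm
  refine Finset.sum_of_injOn (SSYT.castLE h) (SSYT.castLE_injective h).injOn (by simp) ?_ ?_
  · intro T _ hT
    obtain ⟨c, hc, hn⟩ := SSYT.exists_le_of_notMem_range h (T := T) (by simpa using hT)
    exact Finset.prod_eq_zero (Finset.mem_univ ⟨c, hc⟩) (hx _ hn)
  · intro T _
    rfl

/-- The evaluation of a polynomial in `m` variables at `x_i = 0` for all `i ≥ n`. -/
noncomputable def restrictVars (n m : ℕ) : MvPolynomial (Fin m) ℤ →ₐ[ℤ] MvPolynomial (Fin n) ℤ :=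
  aeval fun i => if hi : (i : ℕ) < n then X ⟨i, hi⟩ else 0

theorem restrictVars_schur {n m : ℕ} (h : n ≤ m) (lam : YoungDiagram) :
    restrictVars n m (schur m lam) = schur n lam := by
  have hX : ((fun i : Fin m => if hi : (i : ℕ) < n then X ⟨i, hi⟩ else 0) ∘ Fin.castLE h) =
      (X : Fin n → MvPolynomial (Fin n) ℤ) := by
    ext1 i
    simp
  rw [restrictVars, aeval_schur_castLE h lam _ fun i hi => dif_neg hi.not_gt, hX,
    aeval_X_left_apply]

theorem restrictVars_monomial_castLE {n m : ℕ} (h : n ≤ m) {lam : YoungDiagram} (T : SSYT n lam) :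
    restrictVars n m (T.castLE h).monomial = T.monomial := by
  simp only [SSYT.monomial, restrictVars, map_prod, aeval_X]
  refine Finset.prod_congr rfl fun c _ => ?_
  exact dif_pos (T.2 c.1 c.2)

theorem restrictVars_monomial_eq_zero {n m : ℕ} (h : n ≤ m) {lam : YoungDiagram} {T : SSYT m lam}
    (hT : T ∉ Set.range (SSYT.castLE h)) : restrictVars n m T.monomial = 0 := by
  obtain ⟨c, hc, hn⟩ := SSYT.exists_le_of_notMem_range h hT
  simp only [SSYT.monomial, restrictVars, map_prod, aeval_X]
  exact Finset.prod_eq_zero (Finset.mem_univ ⟨c, hc⟩) (dif_neg hn.not_gt)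

/-- The plethysm may be computed with any enumeration of the tableaux. -/
theorem plethysm_eq {N : ℕ} (mu nu : YoungDiagram)
    (e : Fin (Fintype.card (SSYT N nu)) ≃ SSYT N nu) :
    plethysm N mu nu = aeval (fun i => (e i).monomial) (schur _ mu) := by
  rw [plethysm, ← aeval_comp_perm_schur mu _ (e.trans (Fintype.equivFin _))]
  congr 2
  ext1 i
  simp

theorem restrictVars_plethysm {n m : ℕ} (h : n ≤ m) (mu nu : YoungDiagram) :
    restrictVars n m (plethysm m mu nu) = plethysm n mu nu := by
  classical
  let e0 := (Fintype.equivFin (SSYT n nu)).symm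
  have hcard : Fintype.card (SSYT n nu) ≤ Fintype.card (SSYT m nu) :=
    Fintype.card_le_of_injective _ (SSYT.castLE_injective h)
  -- an enumeration of the tableaux which begins with those over the smaller alphabet
  obtain ⟨e, he⟩ : ∃ e : Fin (Fintype.card (SSYT m nu)) ≃ SSYT m nu,
      ∀ i, e (Fin.castLE hcard i) = (e0 i).castLE h := by
    let f : Fin (Fintype.card (SSYT m nu)) → SSYT m nu := fun i =>
      if hi : (i : ℕ) < Fintype.card (SSYT n nu) then (e0 ⟨i, hi⟩).castLE h
      else (Fintype.equivFin (SSYT m nu)).symm i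
    have hf : ∀ i, f (Fin.castLE hcard i) = (e0 i).castLE h := fun i => dif_pos i.2
    obtain ⟨g, hg⟩ := Finset.exists_equiv_extend_of_card_eq
      (t := (Finset.univ : Finset (SSYT m nu)))
      (s := Finset.univ.image (Fin.castLE hcard)) (f := f) (by simp) (Finset.subset_univ _) (by
        rw [Finset.coe_image, Set.InjOn]
        rintro _ ⟨i, _, rfl⟩ _ ⟨j, _, rfl⟩ hij
        rw [hf, hf] at hij
        rw [e0.injective (SSYT.castLE_injective h hij)])
    refine ⟨g.trans (Equiv.subtypeUnivEquiv Finset.mem_univ), fun i => ?_⟩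
    rw [← hf]
    exact hg _ (Finset.mem_image_of_mem _ (Finset.mem_univ i))
  rw [plethysm_eq mu nu e, plethysm_eq mu nu e0, comp_aeval_apply, aeval_schur_castLE hcard]
  · congr 2
    ext1 i
    simp only [Function.comp_apply]
    rw [he, restrictVars_monomial_castLE]
  · intro i hi
    refine restrictVars_monomial_eq_zero h ?_
    rintro ⟨T, hT⟩
    obtain ⟨k, rfl⟩ := e0.surjective T
    rw [← he] at hT
    have := congrArg Fin.val (e.injective hT)
    rw [Fin.val_castLE] at this
    omega

/-- The number of entries of a tableau equal to a given letter. -/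
noncomputable def SSYT.weight {N : ℕ} {lam : YoungDiagram} (T : SSYT N lam) (e : Fin N) : ℕ :=
  (Finset.univ.filter fun c : lam.cells => (⟨T.1 c.1.1 c.1.2, T.2 c.1 c.2⟩ : Fin N) = e).card

theorem SSYT.monomial_eq {N : ℕ} {lam : YoungDiagram} (T : SSYT N lam) :
    T.monomial = MvPolynomial.monomial (expo T.weight) 1 := by
  rw [monomial_expo, SSYT.monomial]
  rw [← Finset.prod_fiberwise' Finset.univ (fun c : lam.cells =>
    (⟨T.1 c.1.1 c.1.2, T.2 c.1 c.2⟩ : Fin N)) (X : Fin N → MvPolynomial (Fin N) ℤ)]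
  simp only [Finset.prod_const, SSYT.weight]

theorem isSymmetric_plethysm (N : ℕ) (mu nu : YoungDiagram) :
    (plethysm N mu nu).IsSymmetric := by
  classical
  intro s
  have hren : ∀ T : SSYT N nu, rename s T.monomial =
      MvPolynomial.monomial ((expo T.weight).mapDomain s) 1 := by
    intro T
    rw [SSYT.monomial_eq, rename_monomial]
  -- as `s_nu` is symmetric, `s` permutes the multiset of the monomials of the tableaux
  have hfib : ∀ u : Fin N →₀ ℕ,
      Fintype.card {T : SSYT N nu // (expo T.weight).mapDomain s = u} =
        Fintype.card {T : SSYT N nu // expo T.weight = u} := by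
    intro u
    have h := congrArg (coeff u) (isSymmetric_schur N nu s)
    rw [schur, map_sum, coeff_sum, coeff_sum] at h
    simp only [hren] at h
    simp only [SSYT.monomial_eq, coeff_monomial, Finset.sum_boole] at h
    rw [Fintype.card_subtype, Fintype.card_subtype]
    exact_mod_cast h
  let p : SSYT N nu ≃ SSYT N nu := Equiv.ofFiberEquiv fun u => Fintype.equivOfCardEq (hfib u)
  have hp : ∀ T, rename s T.monomial = (p T).monomial := by
    intro T
    rw [hren, SSYT.monomial_eq]
    exact congrArg (fun u => MvPolynomial.monomial u (1 : ℤ))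
      (Equiv.ofFiberEquiv_map (g := fun T : SSYT N nu => expo T.weight)
        (fun u => Fintype.equivOfCardEq (hfib u)) T).symm
  let e := (Fintype.equivFin (SSYT N nu)).symm
  rw [plethysm_eq mu nu e, comp_aeval_apply]
  simp only [hp]
  exact (plethysm_eq mu nu (e.trans p)).symm.trans (plethysm_eq mu nu e)

theorem isHomogeneous_SSYT_monomial {N : ℕ} {lam : YoungDiagram} (T : SSYT N lam) :
    T.monomial.IsHomogeneous lam.card := by
  have := IsHomogeneous.prod Finset.univ
    (fun c : lam.cells => (X ⟨T.1 c.1.1 c.1.2, T.2 c.1 c.2⟩ : MvPolynomial (Fin N) ℤ))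
    (fun _ => 1) fun c _ => isHomogeneous_X _ _
  rw [Finset.sum_const, smul_eq_mul, mul_one, Finset.card_univ, Fintype.card_coe] at this
  exact this

theorem isHomogeneous_plethysm (N : ℕ) (mu nu : YoungDiagram) :
    (plethysm N mu nu).IsHomogeneous (nu.card * mu.card) := by
  refine IsHomogeneous.aeval ?_ _ fun i => isHomogeneous_SSYT_monomial _
  exact IsHomogeneous.sum _ _ _ fun T _ => isHomogeneous_SSYT_monomial T

theorem colLen_le_card (lam : YoungDiagram) : lam.colLen 0 ≤ lam.card := by
  rw [YoungDiagram.colLen_eq_card]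
  exact Finset.card_le_card (Finset.filter_subset _ _)

theorem IsSchurExpansion.apply_eq {mu nu : YoungDiagram} {a : YoungDiagram →₀ ℤ}
    (ha : IsSchurExpansion mu nu a) {N : ℕ} {lam : YoungDiagram} (h : lam.colLen 0 ≤ N) :
    a lam = schurCoeff (plethysm N mu nu) lam := by
  rw [ha N, schurCoeff_sum a h]

/-- As the plethysm is homogeneous of degree `d = |mu| |nu|`, its expansion in `d` variables is
valid in every number of variables. -/
theorem existsUnique_isSchurExpansion (mu nu : YoungDiagram) :
    ∃! a : YoungDiagram →₀ ℤ, IsSchurExpansion mu nu a := by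
  refine existsUnique_of_exists_of_unique ?_ fun a a' ha ha' => ?_
  swap
  · ext lam
    rw [ha.apply_eq le_rfl, ha'.apply_eq le_rfl]
  have hres : ∀ {n m : ℕ} (a : YoungDiagram →₀ ℤ), n ≤ m →
      plethysm m mu nu = (a.sum fun lam c => c • schur m lam) →
      plethysm n mu nu = a.sum fun lam c => c • schur n lam := by
    intro n m a hnm h
    rw [← restrictVars_plethysm hnm, h, map_finsuppSum]
    simp only [map_zsmul, restrictVars_schur hnm]
  choose a ha hsum using fun N => exists_schur_expansion (isSymmetric_plethysm N mu nu)
  set d := nu.card * mu.card with hd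
  have hcard : ∀ N lam, a N lam ≠ 0 → lam.colLen 0 ≤ d := by
    intro N lam h
    rw [hd, ← card_eq_of_schurCoeff_ne_zero (isHomogeneous_plethysm N mu nu) (ha N lam h).1
      (ha N lam h).2]
    exact colLen_le_card lam
  refine ⟨a d, fun N => ?_⟩
  rcases le_total N d with hN | hN
  · exact hres _ hN (hsum d)
  · have : a N = a d := by
      ext lam
      by_cases hlam : lam.colLen 0 ≤ d
      · rw [← schurCoeff_sum (a d) hlam, ← hsum d, hres _ hN (hsum N), schurCoeff_sum (a N) hlam]
      · rw [not_imp_comm.1 (hcard N lam) hlam, not_imp_comm.1 (hcard d lam) hlam]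
    rw [← this]
    exact hsum N

theorem plethysmCoeff_eq {mu nu lam : YoungDiagram} {N : ℕ} (h : lam.colLen 0 ≤ N) :
    plethysmCoeff mu nu lam = schurCoeff (plethysm N mu nu) lam := by
  have hex := (existsUnique_isSchurExpansion mu nu).exists
  rw [plethysmCoeff, dif_pos hex]
  exact hex.choose_spec.apply_eq h

end Expansion

/-! ### The monoid of Gelfand–Tsetlin patterns -/

/-- In a finitely generated commutative monoid, the equations between additive maps to a
cancellative monoid define a finitely generated submonoid. -/
theorem fg_eqLocusM_of_fg {M N : Type*} [AddCommMonoid M] [AddMonoid.FG M] [AddCommMonoid N]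
    [IsCancelAdd N] (f g : M →+ N) : (f.eqLocusM g).FG := by
  obtain ⟨m, q, hq⟩ :=
    AddSubmonoid.fg_iff_exists_fin_addMonoidHom.1 (AddMonoid.FG.fg_top (M := M))
  rw [AddMonoidHom.mrange_eq_top] at hq
  have : f.eqLocusM g = ((f.comp q).eqLocusM (g.comp q)).map q := by
    ext x
    constructor
    · intro hx
      obtain ⟨p, rfl⟩ := hq x
      exact ⟨p, hx, rfl⟩
    · rintro ⟨p, hp, rfl⟩
      exact hp
  rw [this]
  exact (AddSubmonoid.fg_eqLocusM _ _).map q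

/-- The elements `x` with `f x ≤ g x`. -/
def leLocus {M ι : Type*} [AddCommMonoid M] (f g : M →+ (ι → ℕ)) : AddSubmonoid M where
  carrier := {x | f x ≤ g x}
  zero_mem' := by simp
  add_mem' := by
    intro x y hx hy
    simp only [Set.mem_ofPred_eq, map_add] at hx hy ⊢
    exact add_le_add hx hy

theorem fg_leLocus {M ι : Type*} [AddCommMonoid M] [AddMonoid.FG M] [Finite ι]
    (f g : M →+ (ι → ℕ)) : (leLocus f g).FG := by
  have h : leLocus f g = (AddMonoidHom.eqLocusM
      (f.comp (AddMonoidHom.fst M (ι → ℕ)) + AddMonoidHom.snd M (ι → ℕ))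
      (g.comp (AddMonoidHom.fst M (ι → ℕ)))).map (AddMonoidHom.fst M (ι → ℕ)) := by
    ext x
    constructor
    · intro hx
      exact ⟨(x, g x - f x), add_tsub_cancel_of_le hx, rfl⟩
    · rintro ⟨⟨x, s⟩, hs, rfl⟩
      change f x + s = g x at hs
      change f x ≤ g x
      rw [← hs]
      exact le_self_add
  rw [h]
  exact (fg_eqLocusM_of_fg _ _).map _

/-- The Gelfand–Tsetlin patterns with `N` rows form a finitely generated commutative monoid `P`, on
which the top row `shape` and the exponents `wt` of the variables are additive; `s lam` is the
finite set of the patterns with top row `lam`. -/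
theorem exists_pattern_monoid (N : ℕ) :
    ∃ (P : Type) (_ : AddCommMonoid P) (_ : AddMonoid.FG P) (shape wt : P →+ (Fin N → ℕ))
      (s : (Fin N → ℕ) → Finset P), (∀ lam p, p ∈ s lam ↔ shape p = lam) ∧
      ∀ (R : Type) [CommSemiring R] (lam : Fin N → ℕ) (x : Fin N → R),
        gtPoly N lam x = ∑ p ∈ s lam, ∏ i, x i ^ wt p i := by
  classical
  induction N with
  | zero =>
    refine ⟨Unit, inferInstance, inferInstance, 0, 0, fun _ => Finset.univ, fun lam p => ?_, ?_⟩
    · simp [Subsingleton.elim (0 : Fin 0 → ℕ) lam]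
    · simp [gtPoly]
  | succ N ih =>
    obtain ⟨P, _, _, shape, wt, s, hs, hgt⟩ := ih
    -- the two families of inequalities `lam (i + 1) ≤ shape p i` and `shape p i ≤ lam i`
    let f : (Fin (N + 1) → ℕ) × P →+ (Fin N ⊕ Fin N → ℕ) :=
      { toFun := fun q => Sum.elim (fun i => q.1 i.succ) (shape q.2)
        map_zero' := by ext i; cases i <;> simp
        map_add' := fun q q' => by ext i; cases i <;> simp }
    let g : (Fin (N + 1) → ℕ) × P →+ (Fin N ⊕ Fin N → ℕ) :=
      { toFun := fun q => Sum.elim (shape q.2) (fun i => q.1 i.castSucc)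
        map_zero' := by ext i; cases i <;> simp
        map_add' := fun q q' => by ext i; cases i <;> simp }
    have hmem : ∀ q, q ∈ leLocus f g ↔ shape q.2 ∈ interlacing q.1 := by
      intro q
      rw [mem_interlacing, forall_and]
      change f q ≤ g q ↔ _
      rw [Pi.le_def, Sum.forall]
      rfl
    have hle : ∀ q ∈ leLocus f g, ∑ i, shape q.2 i ≤ ∑ i, q.1 i := by
      intro q hq
      rw [hmem, mem_interlacing] at hq
      rw [Fin.sum_univ_castSucc]
      exact (Finset.sum_le_sum fun i _ => (hq i).2).trans (Nat.le_add_right _ _)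
    let wt' : leLocus f g →+ (Fin (N + 1) → ℕ) :=
      { toFun := fun q =>
          Fin.snoc (α := fun _ => ℕ) (wt q.1.2) (∑ i, q.1.1 i - ∑ i, shape q.1.2 i)
        map_zero' := by
          ext i
          refine Fin.lastCases ?_ (fun i => ?_) i <;> simp
        map_add' := by
          rintro ⟨q, hq⟩ ⟨q', hq'⟩
          have h1 := hle q hq
          have h2 := hle q' hq'
          ext i
          refine Fin.lastCases ?_ (fun i => ?_) i
          · simp [Finset.sum_add_distrib]
            omega
          · simp }
    refine ⟨leLocus f g, inferInstance, (AddMonoid.fg_iff_addSubmonoid_fg _).2 (fg_leLocus f g),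
      (AddMonoidHom.fst _ _).comp (leLocus f g).subtype, wt',
      fun lam => ({lam} ×ˢ (interlacing lam).biUnion s).subtype (· ∈ leLocus f g), ?_, ?_⟩
    · rintro lam ⟨⟨lam', p⟩, hp⟩
      rw [hmem] at hp
      simp only [Finset.mem_subtype, Finset.mem_product, Finset.mem_singleton,
        Finset.mem_biUnion, hs, exists_eq_right']
      change _ ↔ lam' = lam
      refine ⟨fun h => h.1, ?_⟩
      rintro rfl
      exact ⟨rfl, hp⟩
    · intro R _ lam x
      have hF : ∀ q : leLocus f g, ∏ i, x i ^ wt' q i =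
          (∏ i, Fin.init x i ^ wt q.1.2 i) *
            x (Fin.last N) ^ (∑ i, q.1.1 i - ∑ i, shape q.1.2 i) := by
        intro q
        rw [Fin.prod_univ_castSucc]
        simp [wt', Fin.init]
      simp only [hF]
      rw [Finset.sum_subtype_of_mem (fun q : (Fin (N + 1) → ℕ) × P =>
        (∏ i, Fin.init x i ^ wt q.2 i) * x (Fin.last N) ^ (∑ i, q.1 i - ∑ i, shape q.2 i)),
        Finset.sum_product, Finset.sum_singleton, Finset.sum_biUnion, gtPoly]
      · refine Finset.sum_congr rfl fun kap _ => ?_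
        rw [hgt, Finset.sum_mul]
        refine Finset.sum_congr rfl fun p hp => ?_
        rw [(hs kap p).1 hp]
      · intro kap _ kap' _ hne
        rw [Function.onFun, Finset.disjoint_left]
        intro p hp hp'
        rw [hs] at hp hp'
        exact hne (hp.symm.trans hp')
      · rintro ⟨lam', p⟩ hp
        simp only [Finset.mem_product, Finset.mem_singleton, Finset.mem_biUnion, hs,
          exists_eq_right'] at hp
        obtain ⟨rfl, hp⟩ := hp
        rwa [hmem]

/-! ### Rationality of the plethysm series -/

/-- The patterns with top row `r • mu` whose content satisfies a linear condition that is affine in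
`r` have a rational generating function. -/
theorem isRationalFunction_card_filter {P : Type*} [AddCommMonoid P] [AddMonoid.FG P]
    {M N : ℕ} (shape : P →+ (Fin M → ℕ)) (content : P →+ (Fin N → ℕ))
    (s : (Fin M → ℕ) → Finset P) (hs : ∀ lam p, p ∈ s lam ↔ shape p = lam)
    (mu : Fin M → ℕ) (lam a b : Fin N → ℕ) :
    IsRationalFunction (PowerSeries.mk fun r : ℕ =>
      (((s (r • mu)).filter fun p => content p + a = r • lam + b).card : ℚ)) := by
  -- `(w, r, p)` satisfies the homogenized equations, with `w = 1` giving back the original ones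
  let f : ℕ × ℕ × P →+ (Fin M → ℕ) × (Fin N → ℕ) :=
    { toFun := fun c => (shape c.2.2, content c.2.2 + c.1 • a)
      map_zero' := by simp
      map_add' := fun c c' => by
        simp only [Prod.fst_add, Prod.snd_add, map_add, add_smul, Prod.mk_add_mk]
        rw [add_add_add_comm] }
  let g : ℕ × ℕ × P →+ (Fin M → ℕ) × (Fin N → ℕ) :=
    { toFun := fun c => (c.2.1 • mu, c.2.1 • lam + c.1 • b)
      map_zero' := by simp
      map_add' := fun c c' => by
        simp only [Prod.fst_add, Prod.snd_add, add_smul, Prod.mk_add_mk]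
        rw [add_add_add_comm] }
  have hfg : AddMonoid.FG (f.eqLocusM g) :=
    (AddMonoid.fg_iff_addSubmonoid_fg _).2 (fg_eqLocusM_of_fg f g)
  let w : f.eqLocusM g →+ ℕ := (AddMonoidHom.fst _ _).comp (f.eqLocusM g).subtype
  let d : f.eqLocusM g →+ ℕ :=
    ((AddMonoidHom.fst _ _).comp (AddMonoidHom.snd _ _)).comp (f.eqLocusM g).subtype
  have himage : ∀ r, Subtype.val '' {c | w c = 1 ∧ d c = r} = (fun p => ((1, r, p) : ℕ × ℕ × P)) ''
      ((s (r • mu)).filter fun p => content p + a = r • lam + b : Finset P) := by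
    intro r
    ext ⟨w', r', p⟩
    constructor
    · rintro ⟨⟨_, hc⟩, ⟨h1, h2⟩, rfl⟩
      obtain rfl : w' = 1 := h1
      obtain rfl : r' = r := h2
      refine ⟨p, ?_, rfl⟩
      obtain ⟨h3, h4⟩ := Prod.ext_iff.1 (AddMonoidHom.mem_eqLocusM.1 hc)
      simp only [f, g, AddMonoidHom.coe_mk, ZeroHom.coe_mk, one_smul] at h3 h4
      simp only [Finset.coe_filter, Set.mem_ofPred_eq, hs]
      exact ⟨h3, h4⟩
    · rintro ⟨p, hp, heq⟩
      simp only [Finset.coe_filter, Set.mem_ofPred_eq, hs] at hp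
      rw [← heq]
      refine ⟨⟨(1, r, p), ?_⟩, ⟨rfl, rfl⟩, rfl⟩
      rw [AddMonoidHom.mem_eqLocusM]
      simp only [f, g, AddMonoidHom.coe_mk, ZeroHom.coe_mk, one_smul]
      rw [hp.1, hp.2]
  have hinj : ∀ r : ℕ, Function.Injective (fun p => ((1, r, p) : ℕ × ℕ × P)) := by
    intro r p p' h
    simpa using h
  have hrat := isRationalFunction_of_fg d w fun r => by
    refine Set.Finite.of_finite_image ?_ Subtype.val_injective.injOn
    rw [himage]
    exact (Finset.finite_toSet _).image _
  convert hrat using 4 with r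
  rw [← Set.ncard_image_of_injective _ Subtype.val_injective, himage,
    Set.ncard_image_of_injective _ (hinj r), Set.ncard_coe_finset]

theorem colLen_scale_le (r : ℕ) (lam : YoungDiagram) :
    (scale r lam).colLen 0 ≤ lam.colLen 0 := by
  by_contra! h
  rw [← YoungDiagram.mem_iff_lt_colLen, YoungDiagram.mem_iff_lt_rowLen, rowLen_scale] at h
  have h1 : 0 < lam.rowLen (lam.colLen 0) := Nat.pos_of_mul_pos_left h
  rw [← YoungDiagram.mem_iff_lt_rowLen, YoungDiagram.mem_iff_lt_colLen] at h1
  exact lt_irrefl _ h1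

theorem lt_colLen_scale {r N : ℕ} (hr : r ≠ 0) {lam : YoungDiagram} (h : N < lam.colLen 0) :
    N < (scale r lam).colLen 0 := by
  rw [← YoungDiagram.mem_iff_lt_colLen, YoungDiagram.mem_iff_lt_rowLen] at h ⊢
  rw [rowLen_scale]
  exact Nat.mul_pos (Nat.pos_of_ne_zero hr) h

theorem rowLen_scale_eq_smul (N r : ℕ) (lam : YoungDiagram) :
    (fun i : Fin N => (scale r lam).rowLen i) = r • fun i : Fin N => lam.rowLen i := by
  ext i
  simp [rowLen_scale]

open MvPolynomial in
/-- The coefficients of the plethysm series are signed counts of patterns. -/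
theorem schurCoeff_plethysm_eq {M N : ℕ} {P : Type} [AddCommMonoid P]
    (wt : P →+ (Fin M → ℕ)) (s : (Fin M → ℕ) → Finset P)
    (hgt : ∀ (R : Type) [CommSemiring R] (lam : Fin M → ℕ) (x : Fin M → R),
        gtPoly M lam x = ∑ p ∈ s lam, ∏ i, x i ^ wt p i)
    (kap mu nu : YoungDiagram) (e : Fin M ≃ SSYT N nu) (hmu : mu.colLen 0 ≤ M) :
    schurCoeff (plethysm N mu nu) kap = ∑ t : Equiv.Perm (Fin N), (Equiv.Perm.sign t : ℤ) *
      ((s fun i => mu.rowLen i).filter fun p =>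
        ∑ k, wt p k • (e k).weight + staircase N ∘ t = shifted N kap).card := by
  obtain rfl : M = Fintype.card (SSYT N nu) := by simpa using Fintype.card_congr e
  have hmon : ∀ p, ∏ k, (e k).monomial ^ wt p k =
      MvPolynomial.monomial (expo (∑ k, wt p k • (e k).weight)) 1 := by
    intro p
    have : expo (∑ k, wt p k • (e k).weight) = ∑ k, wt p k • expo (e k).weight := by
      ext i
      simp [expo]
    rw [this, monomial_sum_one]
    refine Finset.prod_congr rfl fun k _ => ?_
    rw [SSYT.monomial_eq, monomial_pow, one_pow]
  rw [schurCoeff, plethysm_eq mu nu e, aeval_schur_eq_gtPoly hmu, hgt]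
  simp only [hmon]
  rw [alternant_X_eq, Finset.sum_mul, coeff_sum]
  refine Finset.sum_congr rfl fun t _ => ?_
  rw [Finset.mul_sum, coeff_sum, Finset.card_filter]
  push_cast
  rw [Finset.mul_sum]
  refine Finset.sum_congr rfl fun p _ => ?_
  rw [monomial_mul, ← expo_add, coeff_monomial, mul_one, mul_ite, mul_one, mul_zero]
  refine if_congr ?_ rfl rfl
  rw [expo_injective.eq_iff, add_comm]

theorem isRationalFunction_plethysmCoeff (lam mu nu : YoungDiagram) :
    IsRationalFunction (PowerSeries.mk fun r : ℕ =>
      (plethysmCoeff (scale r mu) nu (scale r lam) : ℚ)) := by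
  set N := lam.colLen 0
  have hcoeff : ∀ r, plethysmCoeff (scale r mu) nu (scale r lam) =
      schurCoeff (plethysm N (scale r mu) nu) (scale r lam) := fun r =>
    plethysmCoeff_eq (colLen_scale_le r lam)
  simp only [hcoeff]
  set M := Fintype.card (SSYT N nu) with hM
  rcases le_or_gt (mu.colLen 0) M with hmu | hmu
  · obtain ⟨P, _, _, shape, wt, s, hs, hgt⟩ := exists_pattern_monoid M
    let e := (Fintype.equivFin (SSYT N nu)).symm
    let content : P →+ (Fin N → ℕ) :=
      { toFun := fun p => ∑ k, wt p k • (e k).weight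
        map_zero' := by simp
        map_add' := fun p q => by simp [add_smul, Finset.sum_add_distrib] }
    have hsum : (PowerSeries.mk fun r : ℕ =>
          (schurCoeff (plethysm N (scale r mu) nu) (scale r lam) : ℚ)) =
        ∑ t : Equiv.Perm (Fin N), (Polynomial.C (((Equiv.Perm.sign t : ℤ)) : ℚ) : Polynomial ℚ) *
          PowerSeries.mk fun r : ℕ => (((s (r • fun i : Fin M => mu.rowLen i)).filter fun p =>
            content p + staircase N ∘ t =
              (r • fun i : Fin N => lam.rowLen i) + staircase N).card : ℚ) := by
      ext r
      rw [map_sum, PowerSeries.coeff_mk, schurCoeff_plethysm_eq wt s hgt _ _ nu e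
        ((colLen_scale_le r mu).trans hmu), Int.cast_sum]
      refine Finset.sum_congr rfl fun t _ => ?_
      rw [Polynomial.coe_C, PowerSeries.coeff_C_mul, PowerSeries.coeff_mk, rowLen_scale_eq_smul,
        shifted, rowLen_scale_eq_smul]
      push_cast
      rfl
    rw [hsum]
    exact isRationalFunction_sum _ _ fun t _ =>
      (isRationalFunction_card_filter shape content s hs _ _ _ _).polynomial_mul _
  · -- there are fewer letters than rows of `mu`, so that only the constant term survives
    have hzero : ∀ r ≠ 0, schurCoeff (plethysm N (scale r mu) nu) (scale r lam) = 0 := by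
      intro r hr
      rw [plethysm, schur_eq_zero (lt_colLen_scale hr hmu), map_zero, schurCoeff, mul_zero,
        MvPolynomial.coeff_zero]
    convert isRationalFunction_polynomial
      (Polynomial.C (schurCoeff (plethysm N (scale 0 mu) nu) (scale 0 lam) : ℚ)) using 1
    ext r
    rw [PowerSeries.coeff_mk, Polynomial.coeff_coe, Polynomial.coeff_C]
    split_ifs with hr
    · rw [hr]
    · rw [hzero r hr, Int.cast_zero]

end Plethysm

/-- The first part says that the coefficients `a_{r mu[nu]}^lam` are well defined, the second part
that `∑_{r ≥ 0} a_{r mu[nu]}^{r lam} t^r` is a rational function of `t`. -/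
theorem mainTheorem10 (lam mu nu : YoungDiagram) (hcard : lam.card = mu.card * nu.card) :
    (∀ r : ℕ, ∃! a : YoungDiagram →₀ ℤ,
      Plethysm.IsSchurExpansion (Plethysm.scale r mu) nu a) ∧
    Plethysm.IsRationalFunction (PowerSeries.mk fun r : ℕ =>
      (Plethysm.plethysmCoeff (Plethysm.scale r mu) nu (Plethysm.scale r lam) : ℚ)) :=
  ⟨fun r => Plethysm.existsUnique_isSchurExpansion (Plethysm.scale r mu) nu,
    Plethysm.isRationalFunction_plethysmCoeff lam mu nu⟩
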